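/- Let $X$ be a simply connected compact complex manifold and $L \to X$ a very ample holomorphic line bundle (so that $X$ is a smooth projective variety). Let $h$ be a smooth hermitian structure on $L$ for which the form $\omega_h = \frac{1}{2\pi} d d^c(-\ln|\alpha|_h)$, with $\alpha$ any local nowhere vanishing holomorphic section and $d^c f = -df\circ I$, is a Kähler form. Let $\Gamma(X,L)$ be the space of smooth sections of $L$, with the scalar product $\langle s,t\rangle = \int_X (s,t)_h\, \omega_h^n/n!$, $n=\dim_{\mathbb C}X$, let $\Omega_{FS}$ be the corresponding Fubini–Study form on $\mathbb P\Gamma(X,L)$, and let $H^0(X,L)\subset\Gamma(X,L)$ be the space of holomorphic sections. A smooth deformation is a map $\delta:\mathbb PH^0(X,L)\to C^\infty(X,\mathbb R)$ for which $(p,x)\mapsto\delta(p)(x)$ is smooth on $\mathbb PH^0(X,L)\times X$. Its deformed space is $\mathbb PH^0(X,L)_\delta=\{[e^{i\delta([\alpha])}\alpha] : [\alpha]\in\mathbb PH^0(X,L)\}\subset\mathbb P\Gamma(X,L)$. For $\varepsilon>0$ call $\delta$ $\varepsilon$-small if the oscillation $\max_X f-\min_X f$ is at most $\varepsilon$ for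 every $f=\delta(p)$, $p\in\mathbb PH^0(X,L)$, and for every derivative $f=d\delta_p(v)$ of $\delta$ along a unit tangent vector $v$ of $\mathbb PH^0(X,L)$ at $p$, where $v$ has unit length if it is the velocity at $t=0$ of $[\alpha+t\beta]$ with $\langle\alpha,\alpha\rangle=\langle\beta,\beta\rangle=1$, $\langle\alpha,\beta\rangle=0$. Then $h^0(X,L)=\dim_{\mathbb C}H^0(X,L)$ is finite, and: (1) for every smooth deformation $\delta$, the space $\mathbb PH^0(X,L)_\delta$ is an embedded smooth real submanifold of $\mathbb P\Gamma(X,L)$ of dimension $2(h^0(X,L)-1)$; (2) there is an $\varepsilon>0$ such that for every $\varepsilon$-small smooth deformation $\delta$ this submanifold is symplectic with respect to $\Omega_{FS}$, i.e. $\Omega_{FS}$ is nondegenerate on each of its tangent spaces. -/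

import Mathlib

open Bundle Set MeasureTheory
open scoped Manifold ContDiff LinearAlgebra.Projectivization Topology

noncomputable section

namespace DeformedSystem

/-- The local model of an `n`-dimensional complex manifold. Its `volume` is Lebesgue measure. -/
abbrev Model (n : ℕ) := Fin n → ℂ

section Sections

variable (n : ℕ) {X : Type*} [TopologicalSpace X] [ChartedSpace (Model n) X]
variable (L : X → Type*) [∀ x, AddCommGroup (L x)] [∀ x, Module ℂ (L x)]
  [TopologicalSpace (TotalSpace ℂ L)] [∀ x, TopologicalSpace (L x)] [FiberBundle ℂ L]

/-! ### Smooth and holomorphic sections -/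

/-- `s` is a smooth (real `C^∞`) section of `L`. -/
def IsSmoothSection (s : ∀ x, L x) : Prop :=
  ContMDiff 𝓘(ℝ, Model n) (𝓘(ℝ, Model n).prod 𝓘(ℝ, ℂ)) ∞ (fun x => TotalSpace.mk' ℂ x (s x))

/-- The real smooth functions on `X`. -/
abbrev SmoothFun (n : ℕ) (X : Type*) [TopologicalSpace X] [ChartedSpace (Model n) X] :=
  C^∞⟮𝓘(ℝ, Model n), X; 𝓘(ℝ, ℝ), ℝ⟯

variable [VectorBundle ℂ ℂ L]

variable {n L} in
lemma IsSmoothSection.add {s t : ∀ x, L x} (hs : IsSmoothSection n L s)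
    (ht : IsSmoothSection n L t) : IsSmoothSection n L (s + t) := by
  intro x₀
  have hs0 := (contMDiffAt_section (n := ∞) x₀).1 (hs x₀)
  have ht0 := (contMDiffAt_section (n := ∞) x₀).1 (ht x₀)
  refine (contMDiffAt_section (n := ∞) x₀).2 ((hs0.add ht0).congr_of_eventuallyEq ?_)
  filter_upwards [(trivializationAt ℂ L x₀).open_baseSet.mem_nhds
    (mem_baseSet_trivializationAt ℂ L x₀)] with y hy
  exact ((trivializationAt ℂ L x₀).linear ℂ hy).1 (s y) (t y)

variable {n L} in
lemma IsSmoothSection.smul {s : ∀ x, L x} (hs : IsSmoothSection n L s) {f : X → ℂ}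
    (hf : ContMDiff 𝓘(ℝ, Model n) 𝓘(ℝ, ℂ) ∞ f) : IsSmoothSection n L (fun x => f x • s x) := by
  intro x₀
  have hs0 := (contMDiffAt_section (n := ∞) x₀).1 (hs x₀)
  have hm : ContDiff ℝ ∞ (fun p : ℂ × ℂ => p.1 * p.2) := contDiff_fst.mul contDiff_snd
  have h1 := hm.contMDiff.contMDiffAt.comp x₀ ((hf x₀).prodMk_space hs0)
  refine (contMDiffAt_section (n := ∞) x₀).2 (h1.congr_of_eventuallyEq ?_)
  filter_upwards [(trivializationAt ℂ L x₀).open_baseSet.mem_nhds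
    (mem_baseSet_trivializationAt ℂ L x₀)] with y hy
  exact ((trivializationAt ℂ L x₀).linear ℂ hy).2 (f y) (s y)

/-- `Γ(X, L)`: the complex vector space of smooth sections of `L`. -/
def smoothSections : Submodule ℂ (∀ x, L x) where
  carrier := {s | IsSmoothSection n L s}
  add_mem' hs ht := IsSmoothSection.add hs ht
  zero_mem' := by
    intro x₀
    refine (contMDiffAt_section (n := ∞) x₀).2
      ((contMDiffAt_const (c := (0 : ℂ))).congr_of_eventuallyEq ?_)
    filter_upwards [(trivializationAt ℂ L x₀).open_baseSet.mem_nhds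
      (mem_baseSet_trivializationAt ℂ L x₀)] with y hy
    exact ((trivializationAt ℂ L x₀).linear ℂ hy).map_zero
  smul_mem' c s hs := IsSmoothSection.smul hs (f := fun _ => c) contMDiff_const

/-- `Γ(X, L)` as a type. -/
abbrev Γ := ↥(smoothSections n L)

/-- `H⁰(X, L)`: the space of holomorphic (complex differentiable) sections of `L`, as a complex
subspace of `Γ(X, L)`. -/
def holoSections : Submodule ℂ (Γ n L) where
  carrier := {s | MDifferentiable 𝓘(ℂ, Model n) (𝓘(ℂ, Model n).prod 𝓘(ℂ, ℂ))
    (fun x => TotalSpace.mk' ℂ x (s.1 x))}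
  add_mem' {s t} hs ht := mdifferentiable_add_section (s := s.1) (t := t.1) hs ht
  zero_mem' := mdifferentiable_zeroSection ℂ L
  smul_mem' c s hs := mdifferentiable_smul_const_section (s := s.1) (a := c) hs

/-- `H⁰(X, L)` as a type. -/
abbrev H0 := ↥(holoSections n L)

/-- `L` is very ample: its holomorphic sections have no common zero, separate points, and separate
tangent vectors. For compact `X` this says that the complete linear system of `L` embeds `X`
holomorphically in a projective space. -/
structure IsVeryAmple : Prop where
  base_point_free : ∀ x : X, ∃ s : H0 n L, s.1.1 x ≠ 0
  separates_points : ∀ x y : X, x ≠ y → ∃ s : H0 n L, s.1.1 x = 0 ∧ s.1.1 y ≠ 0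
  separates_tangents : ∀ (x : X) (v : TangentSpace 𝓘(ℂ, Model n) x), v ≠ 0 →
    ∃ s : H0 n L, s.1.1 x = 0 ∧
      mfderiv 𝓘(ℂ, Model n) 𝓘(ℂ, ℂ) (fun y => (trivializationAt ℂ L x ⟨y, s.1.1 y⟩).2) x v ≠ 0

/-! ### Hermitian metrics, the Kähler form and its volume -/

/-- A smooth hermitian structure on the line bundle `L`; conjugate-linear in the first slot.
Smoothness is smoothness of the squared length of each local frame given by a trivialization. -/
structure HermitianMetric where
  inner : ∀ x, L x →ₗ⋆[ℂ] L x →ₗ[ℂ] ℂ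
  conj_symm : ∀ x (v w : L x), (starRingEnd ℂ) (inner x v w) = inner x w v
  pos : ∀ x (v : L x), v ≠ 0 → 0 < (inner x v v).re
  smooth : ∀ b : X, ContMDiffOn 𝓘(ℝ, Model n) 𝓘(ℝ, ℝ) ∞
    (fun x => (inner x ((trivializationAt ℂ L b).symm x (1 : ℂ))
      ((trivializationAt ℂ L b).symm x (1 : ℂ))).re) (trivializationAt ℂ L b).baseSet

variable {n L}

/-- The local Kähler potential `-ln |e|_h`, where `e` is the local holomorphic frame of `L` given by
the preferred trivialization at `b`. -/
def kahlerPotential (h : HermitianMetric n L) (b x : X) : ℝ :=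
  -Real.log (Real.sqrt (h.inner x ((trivializationAt ℂ L b).symm x (1 : ℂ))
    ((trivializationAt ℂ L b).symm x (1 : ℂ))).re)

/-- `d dᶜ ψ` at `y`, evaluated on `ξ, η`, where `dᶜ ψ = -dψ ∘ I`. -/
def ddc (ψ : Model n → ℝ) (y ξ η : Model n) : ℝ :=
  -(fderiv ℝ (fderiv ℝ ψ) y ξ (Complex.I • η)) + fderiv ℝ (fderiv ℝ ψ) y η (Complex.I • ξ)

/-- The form `ω_h = (1/2π) d dᶜ (-ln |e|_h)`, read in the chart `φ` at the point `y` of its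
target. It does not depend on the local holomorphic frame `e` and represents `c₁(L)`. -/
def kahlerForm (h : HermitianMetric n L) (φ : OpenPartialHomeomorph X (Model n))
    (y ξ η : Model n) : ℝ :=
  (1 / (2 * Real.pi)) * ddc (fun z => kahlerPotential h (φ.symm y) (φ.symm z)) y ξ η

/-- `ω_h` is a Kähler form: `ω_h(ξ, Iξ) > 0` for every nonzero tangent vector `ξ`. -/
def IsKahler (h : HermitianMetric n L) : Prop :=
  ∀ φ ∈ atlas (Model n) X, ∀ y ∈ φ.target, ∀ ξ : Model n, ξ ≠ 0 →
    0 < kahlerForm h φ y ξ (Complex.I • ξ)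

/-- The standard real basis `e₁, …, eₙ, i e₁, …, i eₙ` of `ℂⁿ`. -/
def realFrame (n : ℕ) : Fin n ⊕ Fin n → Model n :=
  Sum.elim (fun j => Pi.single j (1 : ℂ)) (fun j => Pi.single j Complex.I)

/-- The density of `ω_hⁿ / n!` with respect to Lebesgue measure in the chart `φ`: the absolute
value of the Pfaffian, i.e. the square root of the determinant, of the matrix of `ω_h`. -/
def liouvilleDensity (h : HermitianMetric n L) (φ : OpenPartialHomeomorph X (Model n))
    (y : Model n) : ℝ :=
  Real.sqrt (Matrix.of fun i j => kahlerForm h φ y (realFrame n i) (realFrame n j)).det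

/-- The Liouville volume of the domain of the chart `φ`, extended by zero to `X`. -/
def chartLiouville [MeasurableSpace X] (h : HermitianMetric n L)
    (φ : OpenPartialHomeomorph X (Model n)) : Measure X :=
  (((volume : Measure (Model n)).restrict φ.target).withDensity
    (fun y => ENNReal.ofReal (liouvilleDensity h φ y))).map φ.symm

/-- The Liouville volume `ω_hⁿ / n!` of `X`. The measures of the single chart domains agree on
overlaps, so that their supremum is the measure glued from them. -/
def liouville [MeasurableSpace X] (h : HermitianMetric n L) : Measure X :=
  ⨆ φ ∈ atlas (Model n) X, chartLiouville h φ

/-- The scalar product `⟨s, t⟩ = ∫_X (s, t)_h dμ_L`, conjugate-linear in `s`. -/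
def l2Inner [MeasurableSpace X] (h : HermitianMetric n L) (s t : ∀ x, L x) : ℂ :=
  ∫ x, h.inner x (s x) (t x) ∂(liouville h)

/-- The Fubini–Study form of `ℙΓ(X, L)` at `[s]`, evaluated on the tangent vectors represented by
`v, w` modulo `ℂ s`; normalized so as to represent `c₁(O(1))`. -/
def fubiniStudy [MeasurableSpace X] (h : HermitianMetric n L) (s v w : ∀ x, L x) : ℝ :=
  (1 / Real.pi) * (l2Inner h v w / l2Inner h s s
    - l2Inner h v s * l2Inner h s w / (l2Inner h s s) ^ 2).im

/-! ### The topology of `ℙΓ(X, L)` and its finite-dimensional submanifolds -/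

/-- The section `s` in the preferred chart and the preferred trivialization at `b`. -/
def localRep (b : X) (s : Γ n L) (y : Model n) : ℂ :=
  (trivializationAt ℂ L b ⟨(chartAt (Model n) b).symm y, s.1 ((chartAt (Model n) b).symm y)⟩).2

variable (n L) in
/-- The open set of `ℂⁿ` on which `localRep b` represents a section. -/
def localDomain (b : X) : Set (Model n) :=
  (chartAt (Model n) b).target ∩
    (chartAt (Model n) b).symm ⁻¹' (trivializationAt ℂ L b).baseSet

variable (n L) in
/-- The `C^∞` topology of `Γ(X, L)`: locally uniform convergence of all derivatives in charts. -/
@[reducible]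
def smoothTopology : TopologicalSpace (Γ n L) :=
  ⨅ (b : X) (k : ℕ), TopologicalSpace.induced
    (fun s => UniformOnFun.ofFun {K : Set (Model n) | IsCompact K ∧ K ⊆ localDomain n L b}
      (iteratedFDeriv ℝ k (localRep b s))) inferInstance

variable (n L) in
/-- The quotient topology of `ℙΓ(X, L)`. -/
@[reducible]
def projTopology : TopologicalSpace (ℙ ℂ (Γ n L)) :=
  TopologicalSpace.coinduced (fun s : {s : Γ n L // s ≠ 0} => Projectivization.mk ℂ s.1 s.2)
    (TopologicalSpace.induced Subtype.val (smoothTopology n L))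

variable {k : ℕ}

/-- The set of points `[σ b]` for `b ∈ V`. -/
def projImage (σ : EuclideanSpace ℝ (Fin k) → Γ n L) (V : Set (EuclideanSpace ℝ (Fin k))) :
    Set (ℙ ℂ (Γ n L)) :=
  {p | ∃ b ∈ V, ∃ hb : σ b ≠ 0, Projectivization.mk ℂ (σ b) hb = p}

/-- The derivative at `b` in the direction `ξ` of a family `σ` of sections: at `x ∈ X`, the
derivative of the map `b ↦ σ b x` to the vector space `L x`. -/
def famDeriv (σ : EuclideanSpace ℝ (Fin k) → Γ n L) (b ξ : EuclideanSpace ℝ (Fin k)) (x : X) :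
    L x :=
  (trivializationAt ℂ L x).symm x
    (fderiv ℝ (fun c => (trivializationAt ℂ L x ⟨x, (σ c).1 x⟩).2) b ξ)

/-- `σ : B → Γ(X, L) ∖ 0` induces a smooth local parametrization `b ↦ [σ b]` of `S ⊆ ℙΓ(X, L)` by
the open set `B ⊆ ℝᵏ`: a smooth injective immersion that is a homeomorphism from `B` to an open
subset of `S`. A map to `Γ(X, L)` is smooth if it is a jointly smooth family of sections. -/
structure IsLocalParam (S : Set (ℙ ℂ (Γ n L))) (B : Set (EuclideanSpace ℝ (Fin k)))
    (σ : EuclideanSpace ℝ (Fin k) → Γ n L) : Prop where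
  isOpen : IsOpen B
  ne_zero : ∀ b ∈ B, σ b ≠ 0
  smooth : ContMDiffOn (𝓘(ℝ, EuclideanSpace ℝ (Fin k)).prod 𝓘(ℝ, Model n))
    (𝓘(ℝ, Model n).prod 𝓘(ℝ, ℂ)) ∞
    (fun q : EuclideanSpace ℝ (Fin k) × X => TotalSpace.mk' ℂ q.2 ((σ q.1).1 q.2)) (B ×ˢ univ)
  immersion : ∀ b ∈ B, ∀ ξ, (∃ c : ℂ, famDeriv σ b ξ = c • (σ b).1) → ξ = 0
  injective : ∀ b ∈ B, ∀ b' ∈ B, (∃ c : ℂ, σ b = c • σ b') → b = b'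
  open_map : ∀ V ⊆ B, IsOpen V → ∃ W, IsOpen[projTopology n L] W ∧ projImage σ V = S ∩ W

variable (k) in
/-- `S` is an embedded smooth real submanifold of `ℙΓ(X, L)` of dimension `k`. -/
def IsSubmanifold (S : Set (ℙ ℂ (Γ n L))) : Prop :=
  ∀ p ∈ S, ∃ B σ, IsLocalParam (k := k) S B σ ∧ p ∈ projImage σ B

variable (k) in
/-- `S` is an embedded smooth real submanifold of `ℙΓ(X, L)` of dimension `k` that is symplectic
with respect to the Fubini–Study form: the form is nondegenerate on each tangent space of `S`. -/
def IsSymplecticSubmanifold [MeasurableSpace X] (h : HermitianMetric n L)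
    (S : Set (ℙ ℂ (Γ n L))) : Prop :=
  ∀ p ∈ S, ∃ B σ, IsLocalParam (k := k) S B σ ∧ p ∈ projImage σ B ∧
    ∀ b ∈ B, ∀ ξ, (∀ η, fubiniStudy h (σ b).1 (famDeriv σ b ξ) (famDeriv σ b η) = 0) → ξ = 0

/-! ### Deformations of the complete linear system -/

/-- Multiplication of a section by the phase `e^{iF}`. -/
def phase (F : SmoothFun n X) : Γ n L →ₗ[ℂ] Γ n L where
  toFun s := ⟨fun x => Complex.exp (Complex.I * (F x : ℂ)) • s.1 x,
    IsSmoothSection.smul (f := fun x => Complex.exp (Complex.I * (F x : ℂ))) s.2 (by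
      have h1 : ContDiff ℝ ∞ (fun t : ℝ => Complex.exp (Complex.I * (t : ℂ))) :=
        (contDiff_const.mul Complex.ofRealCLM.contDiff).cexp
      exact h1.contMDiff.comp F.contMDiff)⟩
  map_add' s t := by
    ext x
    exact smul_add _ _ _
  map_smul' c s := by
    ext x
    exact smul_comm _ _ _

lemma phase_injective (F : SmoothFun n X) :
    Function.Injective (phase F : Γ n L →ₗ[ℂ] Γ n L) := by
  intro s t hst
  ext x
  have h1 : Complex.exp (Complex.I * (F x : ℂ)) • s.1 x
      = Complex.exp (Complex.I * (F x : ℂ)) • t.1 x := congrFun (congrArg Subtype.val hst) x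
  exact smul_right_injective _ (Complex.exp_ne_zero _) h1

/-- The projective transformation `P(F) : [s] ↦ [e^{iF} s]` of `ℙΓ(X, L)`. -/
def projPhase (F : SmoothFun n X) : ℙ ℂ (Γ n L) → ℙ ℂ (Γ n L) :=
  Projectivization.map (phase F) (phase_injective F)

/-- `ℙH⁰(X, L)_δ`: the set of the points `P(δ(p)) p` for `p ∈ ℙH⁰(X, L) ⊆ ℙΓ(X, L)`. -/
def deformedSystem (δ : ℙ ℂ (H0 n L) → SmoothFun n X) : Set (ℙ ℂ (Γ n L)) :=
  range fun p => projPhase (δ p)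
    (Projectivization.map (holoSections n L).subtype (holoSections n L).injective_subtype p)

open scoped Classical in
/-- `δ` as a function of a nonzero section (and zero at the zero section). -/
def onSections (δ : ℙ ℂ (H0 n L) → SmoothFun n X) (s : H0 n L) (x : X) : ℝ :=
  if hs : s ≠ 0 then δ (Projectivization.mk ℂ s hs) x else 0

/-- `δ` is smooth, i.e. `(p, x) ↦ δ(p)(x)` is smooth on `ℙH⁰(X, L) × X`: it is smooth in
homogeneous coordinates `c` on the linear system of each finite family of sections. -/
def IsSmoothDeformation (δ : ℙ ℂ (H0 n L) → SmoothFun n X) : Prop :=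
  ∀ (m : ℕ) (s : Fin m → H0 n L),
    ContMDiffOn (𝓘(ℝ, Fin m → ℂ).prod 𝓘(ℝ, Model n)) 𝓘(ℝ, ℝ) ∞
      (fun q : (Fin m → ℂ) × X => onSections δ (∑ i, q.1 i • s i) q.2)
      {q | ∑ i, q.1 i • s i ≠ 0}

/-- `δ` is `ε`-small: the oscillation over `X` of `δ(p)`, and that of the derivative of `δ` at `p`
along each tangent vector of `ℙH⁰(X, L)` of unit length, is at most `ε`. A unit tangent vector at
`[s]`, `|s| = 1`, is the velocity of `[s + t v]` for a `v` of norm one that is orthogonal to `s`. -/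
def IsSmall [MeasurableSpace X] (h : HermitianMetric n L) (ε : ℝ)
    (δ : ℙ ℂ (H0 n L) → SmoothFun n X) : Prop :=
  (∀ p, ∀ x y : X, δ p x - δ p y ≤ ε) ∧
  ∀ s v : H0 n L, l2Inner h s.1.1 s.1.1 = 1 → l2Inner h v.1.1 v.1.1 = 1 →
    l2Inner h s.1.1 v.1.1 = 0 → ∀ x y : X,
      deriv (fun t : ℝ => onSections δ (s + (t : ℂ) • v) x) 0
        - deriv (fun t : ℝ => onSections δ (s + (t : ℂ) • v) y) 0 ≤ ε

end Sections

end DeformedSystem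

end

set_option linter.unusedSectionVars false

namespace DeformedSystem

/-! ### Holomorphic functions of several variables on convex sets -/

section Convex

variable {E : Type*} [NormedAddCommGroup E] [NormedSpace ℂ E]

/-! Finiteness is a Schwarz lemma argument (`exists_nhds_inner_self_le`). Around each point there is
a neighbourhood on which a section vanishing at that point has squared length at most a quarter of
its global bound. Finitely many such neighbourhoods cover `X`. A section vanishing at their centres
has a maximal squared length bounded by a quarter of itself, so it is zero, and evaluation at the
centres is injective.

For the submanifold, a holomorphic quotient of two sections with values in a set without interior is
constant (`exists_eq_smul_of_forall_eq_smul`). If `e^{iδ(s)} s` and `e^{iδ(t)} t` are proportional,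
then `s / t` has constant modulus, so `[s] = [t]`. The derivative of `e^{iδ} s` along `w` is `e^{iδ}
(i dδ(w) s + w)` (`famDeriv_deformedSection`). If it is a multiple of `e^{iδ} s`, then `w / s` has
constant real part and `w` is a multiple of `s`, so the map is an immersion. It is open onto its
image because the unit sphere of `H⁰` is compact. The cone over the deformations of a compact set of
nonzero sections is closed even for pointwise convergence (`isClosed_cone`), and the `C^∞` topology
is finer than that.

For the symplectic statement it suffices to pair each tangent vector with the one obtained from it
by the complex structure of the linear system. Write `w = u + z s` with `u ⊥ s`. Up to a common
phase and complex multiples of `s`, the two vectors are `u + i P s` and `i u + i Q s`, where `P` and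
`Q` are the derivatives of `δ` along `u` and `i u`, normalized to vanish at one point. The terms
quadratic in `P, Q` are real and drop out of the imaginary part. What remains is `|u|² + Re ∫ Q (u,
s) + Im ∫ P (s, u)`, divided by `π |s|²`. If `|P|, |Q| ≤ |u| / (4 |s|)`, each integral is at most
`|u|² / 4`, so the value is positive (`fubiniStudy_pos`) and `ε = 1/4` works for every `X`, `L` and
`h`.

This uses that the `L²` product is finite and positive definite. The measure is a supremum over
charts, so one needs that `ω_h` and its density transform correctly between charts
(`ddc_comp_add_re`, `liouvilleDensity_transition`), that `X` has finite volume, and that open sets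
have positive volume. -/

/-- Complex lines meet a convex set in a connected set, so the one-variable identity and open
mapping theorems can be applied line by line. -/
lemma convex_preimage_line {U : Set E} (hc : Convex ℝ U) (a w : E) :
    Convex ℝ {t : ℂ | a + t • w ∈ U} := by
  intro t ht t' ht' p q hp hq hpq
  have h1 := hc ht ht' hp hq hpq
  have h2 : a + (p • t + q • t') • w = p • (a + t • w) + q • (a + t' • w) := by
    have h3 : a = p • a + q • a := by rw [← add_smul, hpq, one_smul]
    rw [smul_add, smul_add, add_smul, smul_assoc, smul_assoc]
    nth_rewrite 1 [h3]
    abel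
  change a + (p • t + q • t') • w ∈ U
  rw [h2]
  exact h1

lemma analyticOnNhd_line {U : Set E} (hU : IsOpen U) {f : E → ℂ} (hf : DifferentiableOn ℂ f U)
    (a w : E) : AnalyticOnNhd ℂ (fun t : ℂ => f (a + t • w)) {t : ℂ | a + t • w ∈ U} := by
  have hV : IsOpen {t : ℂ | a + t • w ∈ U} := hU.preimage (by fun_prop)
  refine DifferentiableOn.analyticOnNhd ?_ hV
  have h1 : DifferentiableOn ℂ (fun t : ℂ => a + t • w) {t : ℂ | a + t • w ∈ U} := by fun_prop
  exact hf.comp h1 fun t ht => ht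

/-- The identity theorem on convex open sets. -/
lemma eqOn_zero_of_eventuallyEq_zero {U : Set E} (hU : IsOpen U) (hc : Convex ℝ U) {f : E → ℂ}
    (hf : DifferentiableOn ℂ f U) {a : E} (ha : a ∈ U) (h0 : ∀ᶠ z in 𝓝 a, f z = 0) :
    ∀ z ∈ U, f z = 0 := by
  intro z hz
  have h1 := analyticOnNhd_line hU hf a (z - a)
  have h2 : Filter.Tendsto (fun t : ℂ => a + t • (z - a)) (𝓝 0) (𝓝 a) := by
    have : Continuous (fun t : ℂ => a + t • (z - a)) := by fun_prop
    simpa using this.tendsto 0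
  have h3 := h1.eqOn_zero_of_preconnected_of_eventuallyEq_zero
    (convex_preimage_line hc a (z - a)).isPreconnected (z₀ := 0) (by simpa using ha)
    (h2.eventually h0)
  have h4 := h3 (x := 1) (by simpa using hz)
  simpa using h4

/-- A holomorphic function on a convex open set with values in a set without interior is
constant. -/
lemma eq_of_forall_mem_of_interior_eq_empty {U : Set E} (hU : IsOpen U) (hc : Convex ℝ U)
    {f : E → ℂ} (hf : DifferentiableOn ℂ f U) {S : Set ℂ} (hS : interior S = ∅)
    (hfS : ∀ z ∈ U, f z ∈ S) {a : E} (ha : a ∈ U) : ∀ z ∈ U, f z = f a := by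
  intro z hz
  have hV : IsOpen {t : ℂ | a + t • (z - a) ∈ U} := hU.preimage (by fun_prop)
  rcases (analyticOnNhd_line hU hf a (z - a)).is_constant_or_isOpen
    (convex_preimage_line hc a (z - a)).isPreconnected with ⟨w, hw⟩ | h
  · have h1 := hw 1 (by simpa using hz)
    have h0 := hw 0 (by simpa using ha)
    simp only [one_smul, zero_smul, add_zero, add_sub_cancel] at h0 h1
    rw [h1, h0]
  -- Otherwise the restriction to the line is an open map, and its image would be a nonempty open
  -- subset of `S`.
  · exfalso
    have h1 := h _ subset_rfl hV
    have h2 : f a ∈ interior S := by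
      refine mem_interior.2 ⟨_, ?_, h1, ⟨0, by simpa using ha, by simp⟩⟩
      rintro _ ⟨t, ht, rfl⟩
      exact hfS _ ht
    rw [hS] at h2
    exact h2

end Convex

/-! ### Local representations of holomorphic sections -/

section Sections

variable {n : ℕ} {X : Type*} [TopologicalSpace X] [ChartedSpace (Model n) X]
variable {L : X → Type*} [∀ x, AddCommGroup (L x)] [∀ x, Module ℂ (L x)]
  [TopologicalSpace (TotalSpace ℂ L)] [∀ x, TopologicalSpace (L x)] [FiberBundle ℂ L]
  [VectorBundle ℂ ℂ L]

/-- The linear coordinate on the fibre at `x` given by the preferred trivialization at `b`. -/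
noncomputable def coord (L : X → Type*) [∀ x, AddCommGroup (L x)] [∀ x, Module ℂ (L x)]
    [TopologicalSpace (TotalSpace ℂ L)] [∀ x, TopologicalSpace (L x)] [FiberBundle ℂ L]
    [VectorBundle ℂ ℂ L] (b x : X) : L x →ₗ[ℂ] ℂ :=
  (trivializationAt ℂ L b).linearMapAt ℂ x

lemma coord_apply {b x : X} (hx : x ∈ (trivializationAt ℂ L b).baseSet) (v : L x) :
    coord L b x v = (trivializationAt ℂ L b ⟨x, v⟩).2 := by
  rw [coord, Trivialization.coe_linearMapAt_of_mem _ hx]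

lemma symm_coord {b x : X} (hx : x ∈ (trivializationAt ℂ L b).baseSet) (v : L x) :
    (trivializationAt ℂ L b).symm x (coord L b x v) = v := by
  rw [coord, ← (trivializationAt ℂ L b).coe_symmₗ (R := ℂ),
    (trivializationAt ℂ L b).symmₗ_linearMapAt (R := ℂ) hx v]
  exact hx

lemma coord_symm {b x : X} (hx : x ∈ (trivializationAt ℂ L b).baseSet) (z : ℂ) :
    coord L b x ((trivializationAt ℂ L b).symm x z) = z := by
  rw [coord, ← (trivializationAt ℂ L b).coe_symmₗ (R := ℂ),
    (trivializationAt ℂ L b).linearMapAt_symmₗ (R := ℂ) hx z]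
  exact hx

lemma coord_injective {b x : X} (hx : x ∈ (trivializationAt ℂ L b).baseSet) :
    Function.Injective (coord L b x) := fun v w h => by
  rw [← symm_coord hx v, h, symm_coord hx w]

lemma eq_coord_smul {b x : X} (hx : x ∈ (trivializationAt ℂ L b).baseSet) (v : L x) :
    v = coord L b x v • (trivializationAt ℂ L b).symm x (1 : ℂ) := by
  apply coord_injective hx
  rw [map_smul, coord_symm hx, smul_eq_mul, mul_one]

lemma mem_localDomain_chartAt (b : X) : chartAt (Model n) b b ∈ localDomain n L b :=
  ⟨mem_chart_target _ _, by
    simpa [(chartAt (Model n) b).left_inv (mem_chart_source _ b)] using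
      mem_baseSet_trivializationAt ℂ L b⟩

variable (n L) in
lemma isOpen_localDomain (b : X) : IsOpen (localDomain n L b) :=
  (chartAt (Model n) b).isOpen_inter_preimage_symm (trivializationAt ℂ L b).open_baseSet

lemma localRep_eq_coord {b : X} {y : Model n} (hy : y ∈ localDomain n L b) (s : Γ n L) :
    localRep b s y = coord L b ((chartAt (Model n) b).symm y) (s.1 ((chartAt (Model n) b).symm y)) :=
  (coord_apply hy.2 _).symm

lemma continuousOn_localRep (b : X) (s : Γ n L) :
    ContinuousOn (localRep b s) (localDomain n L b) := by
  intro y hy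
  have h1 : Continuous (fun x => TotalSpace.mk' ℂ x (s.1 x)) := ContMDiff.continuous s.2
  have h2 : ContinuousAt (trivializationAt ℂ L b)
      (TotalSpace.mk' ℂ ((chartAt (Model n) b).symm y) (s.1 ((chartAt (Model n) b).symm y))) :=
    (trivializationAt ℂ L b).continuousAt ((trivializationAt ℂ L b).mem_source.2 hy.2)
  have h3 := (chartAt (Model n) b).continuousAt_symm hy.1
  have h4 := ContinuousAt.comp (f := fun y => TotalSpace.mk' ℂ ((chartAt (Model n) b).symm y)
    (s.1 ((chartAt (Model n) b).symm y))) h2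
      (ContinuousAt.comp (g := fun x => TotalSpace.mk' ℂ x (s.1 x)) h1.continuousAt h3)
  exact h4.snd.continuousWithinAt

variable [IsManifold 𝓘(ℂ, Model n) ω X] [ContMDiffVectorBundle ω ℂ L 𝓘(ℂ, Model n)]

lemma mdifferentiableAt_chartAt_symm {b : X} {y : Model n}
    (hy : y ∈ (chartAt (Model n) b).target) :
    MDifferentiableAt 𝓘(ℂ, Model n) 𝓘(ℂ, Model n) (chartAt (Model n) b).symm y :=
  mdifferentiableAt_atlas_symm (chart_mem_atlas (Model n) b) hy

lemma differentiableOn_localRep (b : X) (s : H0 n L) :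
    DifferentiableOn ℂ (localRep b s.1) (localDomain n L b) := by
  intro y hy
  have : ContMDiffVectorBundle 1 ℂ L 𝓘(ℂ, Model n) := ContMDiffVectorBundle.of_le le_top
  have h1 := ((trivializationAt ℂ L b).mdifferentiableAt_section_iff 𝓘(ℂ, Model n) s.1.1 hy.2).1
    (s.2 _)
  have : IsManifold 𝓘(ℂ, Model n) 1 X := IsManifold.of_le (n := ω) le_top
  have h2 := mdifferentiableAt_chartAt_symm hy.1
  exact (h1.comp y h2).differentiableAt.differentiableWithinAt

lemma apply_eq_zero_of_localRep_eq_zero {b x : X} {s : Γ n L}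
    (hx : x ∈ (chartAt (Model n) b).source) (hy : chartAt (Model n) b x ∈ localDomain n L b)
    (h : localRep b s (chartAt (Model n) b x) = 0) : s.1 x = 0 := by
  have h1 := localRep_eq_coord hy s
  rw [h] at h1
  have h2 := hy.2
  rw [mem_preimage] at h2
  have h3 := coord_injective h2 ((h1.symm).trans (map_zero _).symm)
  rwa [(chartAt (Model n) b).left_inv hx] at h3

lemma exists_ball_subset_localDomain (L : X → Type*) [∀ x, AddCommGroup (L x)]
    [∀ x, Module ℂ (L x)] [TopologicalSpace (TotalSpace ℂ L)] [∀ x, TopologicalSpace (L x)]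
    [FiberBundle ℂ L] (b : X) :
    ∃ r > 0, Metric.ball (chartAt (Model n) b b) r ⊆ localDomain n L b :=
  Metric.isOpen_iff.1 ((chartAt (Model n) b).isOpen_inter_preimage_symm
    (trivializationAt ℂ L b).open_baseSet) _ ⟨mem_chart_target _ _, by
    simpa [(chartAt (Model n) b).left_inv (mem_chart_source _ b)] using
      mem_baseSet_trivializationAt ℂ L b⟩

/-- The identity theorem for holomorphic sections. -/
lemma eq_zero_of_eventually_eq_zero [PreconnectedSpace X] (s : H0 n L) {x₀ : X}
    (h0 : ∀ᶠ x in 𝓝 x₀, s.1.1 x = 0) : s = 0 := by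
  -- The points near which `s` vanishes form a clopen set. At a point of the closure, a chart ball
  -- contains a point of `A`, and the identity theorem spreads the vanishing over the ball.
  set A : Set X := {x : X | ∀ᶠ y in 𝓝 x, s.1.1 y = 0} with hA
  have hopen : IsOpen A := isOpen_setOfPred_eventually_nhds
  have hclosed : IsClosed A := by
    refine isClosed_of_closure_subset fun x hx => ?_
    obtain ⟨r, hr, hsub⟩ := exists_ball_subset_localDomain (n := n) L x
    have hU : (chartAt (Model n) x).source ∩
        chartAt (Model n) x ⁻¹' Metric.ball (chartAt (Model n) x x) r ∈ 𝓝 x :=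
      ((chartAt (Model n) x).isOpen_inter_preimage Metric.isOpen_ball).mem_nhds
        ⟨mem_chart_source _ _, Metric.mem_ball_self hr⟩
    obtain ⟨x₁, ⟨hx1, hx1'⟩, hx1A⟩ := mem_closure_iff_nhds.1 hx _ hU
    have h1 : ∀ᶠ z in 𝓝 (chartAt (Model n) x x₁), localRep x s.1 z = 0 := by
      have hc := (chartAt (Model n) x).continuousAt_symm ((chartAt (Model n) x).map_source hx1)
      rw [ContinuousAt, (chartAt (Model n) x).left_inv hx1] at hc
      filter_upwards [hc.eventually hx1A, Metric.isOpen_ball.mem_nhds hx1'] with z hz hz'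
      rw [localRep_eq_coord (hsub hz'), hz, map_zero]
    have h2 := eqOn_zero_of_eventuallyEq_zero Metric.isOpen_ball (convex_ball _ _)
      ((differentiableOn_localRep x s).mono hsub) hx1' h1
    filter_upwards [hU] with y hy
    exact apply_eq_zero_of_localRep_eq_zero hy.1 (hsub hy.2) (h2 _ hy.2)
  have huniv := IsClopen.eq_univ ⟨hclosed, hopen⟩ ⟨x₀, h0⟩
  ext x
  have hx : x ∈ A := by rw [huniv]; exact mem_univ x
  exact Filter.Eventually.self_of_nhds (p := fun y => s.1.1 y = 0) hx

/-- Holomorphic sections whose pointwise quotient takes values in a set without interior are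
proportional. -/
lemma exists_eq_smul_of_forall_eq_smul [PreconnectedSpace X] {s t : H0 n L} {u : X → ℂ}
    {S : Set ℂ} (hS : interior S = ∅) (hu : ∀ x, u x ∈ S) (hst : ∀ x, s.1.1 x = u x • t.1.1 x)
    (ht : t ≠ 0) : ∃ c : ℂ, s = c • t := by
  obtain ⟨x₀, hx₀⟩ : ∃ x, t.1.1 x ≠ 0 := by
    by_contra! h
    exact ht (by ext x; exact h x)
  have hy₀ : chartAt (Model n) x₀ x₀ ∈ localDomain n L x₀ := mem_localDomain_chartAt x₀
  have hne : localRep x₀ t.1 (chartAt (Model n) x₀ x₀) ≠ 0 := fun h =>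
    hx₀ (apply_eq_zero_of_localRep_eq_zero (mem_chart_source _ _) hy₀ h)
  have hev : ∀ᶠ y in 𝓝 (chartAt (Model n) x₀ x₀), y ∈ localDomain n L x₀ ∧
      localRep x₀ t.1 y ≠ 0 := by
    have hc := (continuousOn_localRep x₀ t.1).continuousAt
      ((isOpen_localDomain n L x₀).mem_nhds hy₀)
    filter_upwards [(isOpen_localDomain n L x₀).mem_nhds hy₀, hc.eventually_ne hne] with y h1 h2
    exact ⟨h1, h2⟩
  obtain ⟨r, hr, hball⟩ := Metric.eventually_nhds_iff_ball.1 hev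
  have hquot : ∀ y ∈ localDomain n L x₀, localRep x₀ s.1 y
      = u ((chartAt (Model n) x₀).symm y) * localRep x₀ t.1 y := fun y hy => by
    rw [localRep_eq_coord hy, localRep_eq_coord hy, hst, map_smul, smul_eq_mul]
  -- On a ball where `t` has no zero, `u` is the quotient of two holomorphic functions.
  have hconst := eq_of_forall_mem_of_interior_eq_empty Metric.isOpen_ball (convex_ball _ r)
    (f := fun y => localRep x₀ s.1 y / localRep x₀ t.1 y)
    (by
      simp_rw [div_eq_mul_inv]
      exact ((differentiableOn_localRep x₀ s).mono fun y hy => (hball y hy).1).fun_mul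
        (((differentiableOn_localRep x₀ t).mono fun y hy => (hball y hy).1).fun_inv
          fun y hy => (hball y hy).2)) hS (fun y hy => by
        rw [hquot y (hball y hy).1, mul_div_cancel_right₀ _ (hball y hy).2]
        exact hu _) (Metric.mem_ball_self hr)
  set c : ℂ := localRep x₀ s.1 (chartAt (Model n) x₀ x₀) /
    localRep x₀ t.1 (chartAt (Model n) x₀ x₀)
  refine ⟨c, sub_eq_zero.1 (eq_zero_of_eventually_eq_zero (s - c • t) (x₀ := x₀) ?_)⟩
  have hU : (chartAt (Model n) x₀).source ∩
      chartAt (Model n) x₀ ⁻¹' Metric.ball (chartAt (Model n) x₀ x₀) r ∈ 𝓝 x₀ :=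
    ((chartAt (Model n) x₀).isOpen_inter_preimage Metric.isOpen_ball).mem_nhds
      ⟨mem_chart_source _ _, Metric.mem_ball_self hr⟩
  filter_upwards [hU] with x hx
  refine apply_eq_zero_of_localRep_eq_zero hx.1 (hball _ hx.2).1 ?_
  have h1 := hconst _ hx.2
  rw [div_eq_iff (hball _ hx.2).2, localRep_eq_coord (hball _ hx.2).1,
    localRep_eq_coord (hball _ hx.2).1] at h1
  rw [localRep_eq_coord (hball _ hx.2).1]
  change coord L x₀ _ (s.1.1 _ - c • t.1.1 _) = 0
  rw [map_sub, map_smul, h1, smul_eq_mul, sub_self]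

end Sections

/-! ### Hermitian products of sections -/

section Hermitian

variable {n : ℕ} {X : Type*} [TopologicalSpace X] [ChartedSpace (Model n) X]
variable {L : X → Type*} [∀ x, AddCommGroup (L x)] [∀ x, Module ℂ (L x)]
  [TopologicalSpace (TotalSpace ℂ L)] [∀ x, TopologicalSpace (L x)] [FiberBundle ℂ L]
  [VectorBundle ℂ ℂ L]

/-- The squared length of the local frame given by the preferred trivialization at `b`. -/
noncomputable def frameSq (h : HermitianMetric n L) (b x : X) : ℝ :=
  (h.inner x ((trivializationAt ℂ L b).symm x (1 : ℂ))
    ((trivializationAt ℂ L b).symm x (1 : ℂ))).re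

lemma inner_self_eq_re (h : HermitianMetric n L) (x : X) (v : L x) :
    h.inner x v v = ((h.inner x v v).re : ℂ) :=
  (Complex.conj_eq_iff_re.1 (h.conj_symm x v v)).symm

lemma inner_self_re_nonneg (h : HermitianMetric n L) (x : X) (v : L x) :
    0 ≤ (h.inner x v v).re := by
  by_cases hv : v = 0
  · simp [hv]
  · exact (h.pos x v hv).le

lemma eq_zero_of_inner_self_re_nonpos (h : HermitianMetric n L) {x : X} {v : L x}
    (hv : (h.inner x v v).re ≤ 0) : v = 0 := by
  by_contra h0
  exact absurd (h.pos x v h0) (not_lt.2 hv)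

lemma frameSq_pos (h : HermitianMetric n L) {b x : X}
    (hx : x ∈ (trivializationAt ℂ L b).baseSet) : 0 < frameSq h b x := by
  refine h.pos x _ fun h0 => ?_
  have h1 := coord_symm hx (1 : ℂ)
  rw [h0, map_zero] at h1
  exact zero_ne_one h1

/-- The fibres are lines, so in a local frame the metric is the single positive function `frameSq`.
Continuity of all products of sections reduces to that of this function. -/
lemma inner_eq (h : HermitianMetric n L) {b x : X}
    (hx : x ∈ (trivializationAt ℂ L b).baseSet) (v w : L x) :
    h.inner x v w = (starRingEnd ℂ) (coord L b x v) * coord L b x w * (frameSq h b x : ℂ) := by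
  conv_lhs => rw [eq_coord_smul hx v, eq_coord_smul hx w]
  rw [LinearMap.map_smulₛₗ (h.inner x), LinearMap.smul_apply, map_smul, inner_self_eq_re, frameSq,
    smul_eq_mul, smul_eq_mul, mul_assoc]

lemma inner_self_re_eq (h : HermitianMetric n L) {b x : X}
    (hx : x ∈ (trivializationAt ℂ L b).baseSet) (v : L x) :
    (h.inner x v v).re = ‖coord L b x v‖ ^ 2 * frameSq h b x := by
  rw [inner_eq h hx, Complex.conj_mul', ← Complex.ofReal_pow, ← Complex.ofReal_mul,
    Complex.ofReal_re]

lemma continuousOn_frameSq (h : HermitianMetric n L) (b : X) :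
    ContinuousOn (frameSq h b) (trivializationAt ℂ L b).baseSet :=
  (h.smooth b).continuousOn

lemma continuousOn_coord (b : X) (s : Γ n L) :
    ContinuousOn (fun x => coord L b x (s.1 x)) (trivializationAt ℂ L b).baseSet := by
  intro x hx
  have h1 : Continuous (fun x => TotalSpace.mk' ℂ x (s.1 x)) := ContMDiff.continuous s.2
  have h2 : ContinuousAt (trivializationAt ℂ L b) (TotalSpace.mk' ℂ x (s.1 x)) :=
    (trivializationAt ℂ L b).continuousAt ((trivializationAt ℂ L b).mem_source.2 hx)
  have h3 := ContinuousAt.comp (f := fun x => TotalSpace.mk' ℂ x (s.1 x)) h2 h1.continuousAt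
  refine (h3.snd.congr ?_).continuousWithinAt
  filter_upwards [(trivializationAt ℂ L b).open_baseSet.mem_nhds hx] with y hy
  exact (coord_apply hy _).symm

lemma continuous_inner (h : HermitianMetric n L) (s t : Γ n L) :
    Continuous fun x => h.inner x (s.1 x) (t.1 x) := by
  refine continuous_iff_continuousAt.2 fun b => ?_
  have hb := (trivializationAt ℂ L b).open_baseSet.mem_nhds (mem_baseSet_trivializationAt ℂ L b)
  have h1 := (continuousOn_coord b s).continuousAt hb
  have h2 := (continuousOn_coord b t).continuousAt hb
  have h3 := (continuousOn_frameSq h b).continuousAt hb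
  refine ContinuousAt.congr (((Complex.continuous_conj.continuousAt.comp h1).mul h2).mul
    (Complex.continuous_ofReal.continuousAt.comp h3)) ?_
  filter_upwards [hb] with x hx
  exact (inner_eq h hx _ _).symm

end Hermitian

/-! ### Finite dimensionality -/

section Finite

variable {n : ℕ} {X : Type*} [TopologicalSpace X] [ChartedSpace (Model n) X]
variable {L : X → Type*} [∀ x, AddCommGroup (L x)] [∀ x, Module ℂ (L x)]
  [TopologicalSpace (TotalSpace ℂ L)] [∀ x, TopologicalSpace (L x)] [FiberBundle ℂ L]
  [VectorBundle ℂ ℂ L] [IsManifold 𝓘(ℂ, Model n) ω X] [ContMDiffVectorBundle ω ℂ L 𝓘(ℂ, Model n)]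

/-- The Schwarz lemma for holomorphic sections: a section that vanishes at a point is small near
it, compared with its global bound. -/
lemma exists_nhds_inner_self_le (h : HermitianMetric n L) (x₀ : X) :
    ∃ U ∈ 𝓝 x₀, ∀ s : H0 n L, s.1.1 x₀ = 0 → ∀ M : ℝ,
      (∀ x, (h.inner x (s.1.1 x) (s.1.1 x)).re ≤ M) →
      ∀ x ∈ U, (h.inner x (s.1.1 x) (s.1.1 x)).re ≤ M / 4 := by
  set φ := chartAt (Model n) x₀ with hφ
  set y₀ := φ x₀ with hy₀
  have hx₀ : φ.symm y₀ = x₀ := φ.left_inv (mem_chart_source _ x₀)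
  have hD : y₀ ∈ localDomain n L x₀ := mem_localDomain_chartAt x₀
  have hH0 : 0 < frameSq h x₀ x₀ := frameSq_pos h (mem_baseSet_trivializationAt ℂ L x₀)
  have hcont : ContinuousAt (fun y => frameSq h x₀ (φ.symm y)) y₀ := by
    have h1 := (continuousOn_frameSq h x₀).continuousAt
      ((trivializationAt ℂ L x₀).open_baseSet.mem_nhds (mem_baseSet_trivializationAt ℂ L x₀))
    have h1 : ContinuousAt (frameSq h x₀) (φ.symm y₀) := by rwa [hx₀]
    exact ContinuousAt.comp (g := frameSq h x₀) h1 (φ.continuousAt_symm hD.1)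
  -- Comparing the metric with its value at the centre costs a factor 2 twice. The Schwarz lemma on
  -- a ball of a quarter of the radius gains `1/16` on squares, which leaves `1/4`.
  have hev : ∀ᶠ y in 𝓝 y₀, y ∈ localDomain n L x₀ ∧ frameSq h x₀ x₀ / 2 < frameSq h x₀ (φ.symm y)
      ∧ frameSq h x₀ (φ.symm y) < 2 * frameSq h x₀ x₀ := by
    rw [ContinuousAt, hx₀] at hcont
    filter_upwards [(isOpen_localDomain n L x₀).mem_nhds hD,
      hcont.eventually_const_lt (half_lt_self hH0),
      hcont.eventually_lt_const (by linarith : frameSq h x₀ x₀ < 2 * frameSq h x₀ x₀)]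
      with y h1 h2 h3
    exact ⟨h1, h2, h3⟩
  obtain ⟨R, hR, hball⟩ := Metric.eventually_nhds_iff_ball.1 hev
  refine ⟨φ.source ∩ φ ⁻¹' Metric.ball y₀ (R / 4),
    (φ.isOpen_inter_preimage Metric.isOpen_ball).mem_nhds
      ⟨mem_chart_source _ _, Metric.mem_ball_self (by linarith)⟩, ?_⟩
  intro s hs M hM x hx
  have hM0 : 0 ≤ M := (inner_self_re_nonneg h x₀ _).trans (hM x₀)
  have hnorm : ∀ y ∈ Metric.ball y₀ R, (h.inner (φ.symm y) (s.1.1 (φ.symm y))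
      (s.1.1 (φ.symm y))).re = ‖localRep x₀ s.1 y‖ ^ 2 * frameSq h x₀ (φ.symm y) := by
    intro y hy
    rw [inner_self_re_eq h (hball y hy).1.2, localRep_eq_coord (hball y hy).1]
  have hzero : localRep x₀ s.1 y₀ = 0 := by
    rw [localRep_eq_coord hD, ← hφ, hx₀, hs, map_zero]
  set K := Real.sqrt (2 * M / frameSq h x₀ x₀) with hK
  have hbound : MapsTo (localRep x₀ s.1) (Metric.ball y₀ R)
      (Metric.closedBall (localRep x₀ s.1 y₀) K) := by
    intro y hy
    rw [hzero, mem_closedBall_zero_iff]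
    refine Real.le_sqrt_of_sq_le ?_
    rw [le_div_iff₀ hH0]
    have h1 := hM (φ.symm y)
    rw [hnorm y hy] at h1
    nlinarith [(hball y hy).2.1, sq_nonneg ‖localRep x₀ s.1 y‖]
  have hxb : φ x ∈ Metric.ball y₀ R := Metric.ball_subset_ball (by linarith) hx.2
  have hsch := Complex.dist_le_div_mul_dist_of_mapsTo_ball
    ((differentiableOn_localRep x₀ s).mono fun y hy => (hball y hy).1) hbound hxb
  rw [hzero, dist_zero_right] at hsch
  have hd : dist (φ x) y₀ ≤ R / 4 := le_of_lt hx.2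
  have hle : ‖localRep x₀ s.1 (φ x)‖ ≤ K / 4 := by
    refine hsch.trans ?_
    have hK0 : 0 ≤ K / R := div_nonneg (Real.sqrt_nonneg _) hR.le
    calc K / R * dist (φ x) y₀ ≤ K / R * (R / 4) := mul_le_mul_of_nonneg_left hd hK0
      _ = K / 4 := by field_simp
  have hKsq : K ^ 2 = 2 * M / frameSq h x₀ x₀ := Real.sq_sqrt (by positivity)
  have hsq : ‖localRep x₀ s.1 (φ x)‖ ^ 2 ≤ 2 * M / frameSq h x₀ x₀ / 16 := by
    rw [← hKsq]
    nlinarith [norm_nonneg (localRep x₀ s.1 (φ x))]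
  have h1 := hnorm (φ x) hxb
  rw [φ.left_inv hx.1] at h1
  rw [h1]
  calc ‖localRep x₀ s.1 (φ x)‖ ^ 2 * frameSq h x₀ x
      ≤ 2 * M / frameSq h x₀ x₀ / 16 * (2 * frameSq h x₀ x₀) := by
        have h2 := (hball _ hxb).2.2
        have h3 := (hball _ hxb).2.1
        rw [φ.left_inv hx.1] at h2 h3
        exact mul_le_mul hsq h2.le (by linarith) (by positivity)
    _ = M / 4 := by field_simp; ring

/-- The space of holomorphic sections of a line bundle on a compact complex manifold is finite
dimensional. -/
theorem finiteDimensional_H0 [CompactSpace X] [Nonempty X] (h : HermitianMetric n L) :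
    FiniteDimensional ℂ (H0 n L) := by
  choose U hU hUs using exists_nhds_inner_self_le (n := n) (L := L) h
  obtain ⟨t, ht⟩ := isCompact_univ.elim_nhds_subcover U fun x _ => hU x
  let ev : H0 n L →ₗ[ℂ] (t → ℂ) :=
    { toFun := fun s x => coord L x.1 x.1 (s.1.1 x.1)
      map_add' := fun s s' => by ext x; exact map_add _ _ _
      map_smul' := fun c s => by ext x; exact map_smul _ _ _ }
  suffices hker : ∀ s, ev s = 0 → s = 0 from Module.Finite.of_injective ev fun s s' hss =>
    sub_eq_zero.1 (hker _ (by rw [map_sub, hss, sub_self]))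
  intro s hs
  have hz : ∀ x ∈ t, s.1.1 x = 0 := fun x hx =>
    coord_injective (mem_baseSet_trivializationAt ℂ L x)
      ((congrFun hs ⟨x, hx⟩).trans (map_zero _).symm)
  -- At a maximum point the squared length is at most a quarter of the maximum, so the maximum is
  -- not positive.
  have hcont : Continuous fun x => (h.inner x (s.1.1 x) (s.1.1 x)).re :=
    Complex.continuous_re.comp (continuous_inner h s.1 s.1)
  obtain ⟨x₁, -, hx₁⟩ := isCompact_univ.exists_isMaxOn univ_nonempty hcont.continuousOn
  obtain ⟨x, hx, hxU⟩ := mem_iUnion₂.1 (ht.2 (mem_univ x₁))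
  have hle := hUs x s (hz x hx) _ (fun y => hx₁ (mem_univ y)) x₁ hxU
  ext y
  refine eq_zero_of_inner_self_re_nonpos h ?_
  have hy := hx₁ (mem_univ y)
  simp only [mem_ofPred_eq] at hy
  linarith

end Finite

/-! ### Cones and affine charts -/

/-- The complex cone over a compact family of nonzero functions is closed for pointwise
convergence. -/
lemma isClosed_cone {V ι : Type*} [TopologicalSpace V] {K : Set V} (hK : IsCompact K)
    {g : V → ι → ℂ} (hg : ContinuousOn g K) (hne : ∀ c ∈ K, g c ≠ 0) :
    IsClosed {f : ι → ℂ | ∃ c ∈ K, ∃ z : ℂ, f = z • g c} := by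
  rw [isClosed_iff_ultrafilter]
  intro f u hu hS
  obtain ⟨-, v, -⟩ := u.nonempty_of_mem hS
  have : Nonempty V := ⟨v⟩
  -- Along an ultrafilter the parameters `c` converge by compactness of `K`. The scalars `z` then
  -- converge too, as quotients at an index where the limit of `g` is nonzero.
  choose! c hc z hz using fun (f : ι → ℂ) (hf : f ∈ {f : ι → ℂ | ∃ c ∈ K, ∃ z : ℂ, f = z • g c}) =>
    hf
  have hcK : K ∈ u.map c := Ultrafilter.mem_map.2 (Filter.mem_of_superset hS hc)
  obtain ⟨c₀, hc₀, hlim⟩ := hK.ultrafilter_le_nhds' _ hcK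
  have h1 : Filter.Tendsto c u (𝓝[K] c₀) := tendsto_nhdsWithin_iff.2 ⟨hlim, hcK⟩
  have h2 : Filter.Tendsto (fun f' => g (c f')) u (𝓝 (g c₀)) := (hg c₀ hc₀).tendsto.comp h1
  rw [tendsto_pi_nhds] at h2
  have h3 : ∀ i, Filter.Tendsto (fun f' : ι → ℂ => f' i) u (𝓝 (f i)) := fun i =>
    ((continuous_apply i).tendsto f).comp hu
  obtain ⟨i, hi⟩ : ∃ i, g c₀ i ≠ 0 := by
    by_contra! h
    exact hne c₀ hc₀ (funext h)
  have h4 : Filter.Tendsto z u (𝓝 (f i / g c₀ i)) := by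
    refine ((h3 i).div (h2 i) hi).congr' ?_
    filter_upwards [hS, (h2 i).eventually_ne hi] with f' hf' hne'
    have h5 := congrFun (hz f' hf') i
    rw [Pi.div_apply, h5, Pi.smul_apply, smul_eq_mul, mul_div_cancel_right₀ _ hne']
  refine ⟨c₀, hc₀, f i / g c₀ i, funext fun j => ?_⟩
  refine tendsto_nhds_unique (h3 j) ((h4.mul (h2 j)).congr' ?_)
  filter_upwards [hS] with f' hf'
  exact (congrFun (hz f' hf') j).symm

/-- An affine chart of the projective space of `ℂᴺ` around a point, with real coordinates: the
points of the chart are the lines through `c₀ + A b`. -/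
lemma exists_affine_chart {N : ℕ} {c₀ : Fin N → ℂ} (hc₀ : c₀ ≠ 0) :
    ∃ (l : (Fin N → ℂ) →L[ℂ] ℂ) (A : EuclideanSpace ℝ (Fin (2 * (N - 1))) →L[ℝ] (Fin N → ℂ))
      (A' : (Fin N → ℂ) →L[ℝ] EuclideanSpace ℝ (Fin (2 * (N - 1)))),
      l c₀ = 1 ∧ (∀ b, l (A b) = 0) ∧ (∀ b, A' (A b) = b) ∧ ∀ c, l c = 0 → A (A' c) = c := by
  obtain ⟨j, hj⟩ : ∃ j, c₀ j ≠ 0 := by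
    by_contra! h
    exact hc₀ (funext h)
  let l : (Fin N → ℂ) →L[ℂ] ℂ := (c₀ j)⁻¹ • ContinuousLinearMap.proj (R := ℂ) (φ := fun _ => ℂ) j
  have hl : l c₀ = 1 := inv_mul_cancel₀ hj
  let K : Submodule ℂ (Fin N → ℂ) := LinearMap.ker l.toLinearMap
  -- The truncated subtraction is harmless: `l` is onto, so `N ≥ 1`.
  have hK : Module.finrank ℂ K = N - 1 := by
    have h1 := LinearMap.finrank_range_add_finrank_ker l.toLinearMap
    have h2 : LinearMap.range l.toLinearMap = ⊤ := LinearMap.range_eq_top.2 fun z =>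
      ⟨z • c₀, by change l (z • c₀) = z; rw [map_smul, hl, smul_eq_mul, mul_one]⟩
    rw [h2, finrank_top, Module.finrank_self, Module.finrank_fin_fun] at h1
    change Module.finrank ℂ (LinearMap.ker l.toLinearMap) = N - 1
    omega
  have hR : Module.finrank ℝ (EuclideanSpace ℝ (Fin (2 * (N - 1)))) = Module.finrank ℝ K := by
    rw [finrank_real_of_complex, hK, finrank_euclideanSpace_fin]
  have : FiniteDimensional ℝ K := FiniteDimensional.complexToReal K
  let e : EuclideanSpace ℝ (Fin (2 * (N - 1))) ≃ₗ[ℝ] K := LinearEquiv.ofFinrankEq _ _ hR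
  -- The projection onto the kernel of `l` along `c₀`. It extends the inverse of the coordinates on
  -- the kernel to the whole space.
  let P : (Fin N → ℂ) →ₗ[ℂ] K :=
    LinearMap.codRestrict K (LinearMap.id - l.toLinearMap.smulRight c₀) fun c => by
      change l (c - l c • c₀) = 0
      rw [map_sub, map_smul, hl, smul_eq_mul, mul_one, sub_self]
  have hP : ∀ c (hc : l c = 0), P c = ⟨c, hc⟩ := fun c hc => by
    apply Subtype.ext
    change c - l c • c₀ = c
    rw [hc, zero_smul, sub_zero]
  refine ⟨l, ((K.subtype.restrictScalars ℝ) ∘ₗ e.toLinearMap).toContinuousLinearMap,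
    (e.symm.toLinearMap ∘ₗ P.restrictScalars ℝ).toContinuousLinearMap, hl, fun b => (e b).2,
    fun b => ?_, fun c hc => ?_⟩
  · change e.symm (P (e b : Fin N → ℂ)) = b
    rw [hP _ (e b).2, Subtype.coe_eta, LinearEquiv.symm_apply_apply]
  · change ((e (e.symm (P c)) : K) : Fin N → ℂ) = c
    rw [LinearEquiv.apply_symm_apply, hP c hc]

section Topology

variable {n : ℕ} {X : Type*} [TopologicalSpace X] [ChartedSpace (Model n) X]
variable {L : X → Type*} [∀ x, AddCommGroup (L x)] [∀ x, Module ℂ (L x)]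
  [TopologicalSpace (TotalSpace ℂ L)] [∀ x, TopologicalSpace (L x)] [FiberBundle ℂ L]
  [VectorBundle ℂ ℂ L]

variable (n L) in
/-- The values of a section, in the preferred trivializations at the points. -/
noncomputable def evalCoord : Γ n L →ₗ[ℂ] (X → ℂ) where
  toFun s x := coord L x x (s.1 x)
  map_add' _ _ := funext fun x => map_add (coord L x x) _ _
  map_smul' _ _ := funext fun x => map_smul (coord L x x) _ _

lemma evalCoord_injective : Function.Injective (evalCoord n L) := fun s t hst => by
  ext x
  exact coord_injective (mem_baseSet_trivializationAt ℂ L x) (congrFun hst x)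

/-- The `C^∞` topology is finer than that of pointwise convergence. -/
lemma continuous_evalCoord : @Continuous _ _ (smoothTopology n L) _ (evalCoord n L) := by
  let _ := smoothTopology n L
  refine continuous_pi fun x => ?_
  -- The derivative of order zero on the compact set consisting of one point gives the value there.
  have hle : smoothTopology n L ≤ TopologicalSpace.induced
      (fun s => UniformOnFun.ofFun {K : Set (Model n) | IsCompact K ∧ K ⊆ localDomain n L x}
      (iteratedFDeriv ℝ 0 (localRep x s))) inferInstance := (iInf_le _ x).trans (iInf_le _ 0)
  have h1 := continuous_iff_le_induced.2 hle
  have h2 := (UniformOnFun.uniformContinuous_eval_of_mem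
    (ContinuousMultilinearMap ℝ (fun _ : Fin 0 => Model n) ℂ)
    {K : Set (Model n) | IsCompact K ∧ K ⊆ localDomain n L x}
    (mem_singleton (chartAt (Model n) x x))
    ⟨isCompact_singleton, singleton_subset_iff.2 (mem_localDomain_chartAt x)⟩).continuous.comp h1
  have h3 := (ContinuousMultilinearMap.apply ℝ (fun _ : Fin 0 => Model n) ℂ 0).continuous.comp h2
  refine h3.congr fun s => ?_
  change iteratedFDeriv ℝ 0 (localRep x s) (chartAt (Model n) x x) 0 = coord L x x (s.1 x)
  rw [iteratedFDeriv_zero_apply, localRep_eq_coord (mem_localDomain_chartAt x),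
    (chartAt (Model n) x).left_inv (mem_chart_source _ x)]

/-- The complement of the projectivization of a closed cone is open. -/
lemma isOpen_setOf_rep_notMem {Z : Set (X → ℂ)} (hZ : IsClosed Z)
    (hcone : ∀ (a : ℂ) (f : X → ℂ), f ∈ Z → a • f ∈ Z) :
    IsOpen[projTopology n L] {p | evalCoord n L p.rep ∉ Z} := by
  rw [isOpen_coinduced]
  -- Since `Z` is stable under scalars, membership does not depend on the representative chosen by
  -- `rep`.
  have heq : (fun s : {s : Γ n L // s ≠ 0} => Projectivization.mk ℂ s.1 s.2) ⁻¹'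
      {p | evalCoord n L p.rep ∉ Z} = Subtype.val ⁻¹' (evalCoord n L ⁻¹' Zᶜ) := by
    ext s
    obtain ⟨a, ha⟩ := Projectivization.exists_smul_eq_mk_rep ℂ s.1 s.2
    simp only [mem_preimage, mem_ofPred_eq, mem_compl_iff, ← ha]
    refine not_congr ⟨fun h => ?_, fun h => ?_⟩
    · have := hcone (a⁻¹ : ℂˣ) _ h
      rw [Units.smul_def, map_smul, smul_smul, ← Units.val_mul, inv_mul_cancel, Units.val_one,
        one_smul] at this
      exact this
    · rw [Units.smul_def, map_smul]
      exact hcone _ _ h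
  rw [heq]
  let _ := smoothTopology n L
  exact isOpen_induced_iff.2 ⟨_, hZ.isOpen_compl.preimage continuous_evalCoord, rfl⟩

end Topology

/-! ### Deformed sections -/

section Deformation

variable {n : ℕ} {X : Type*} [TopologicalSpace X] [ChartedSpace (Model n) X]
variable {L : X → Type*} [∀ x, AddCommGroup (L x)] [∀ x, Module ℂ (L x)]
  [TopologicalSpace (TotalSpace ℂ L)] [∀ x, TopologicalSpace (L x)] [FiberBundle ℂ L]
  [VectorBundle ℂ ℂ L] {δ : ℙ ℂ (H0 n L) → SmoothFun n X}

open scoped Classical in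
/-- The section `e^{iδ([s])} s`. -/
noncomputable def deformedSection (δ : ℙ ℂ (H0 n L) → SmoothFun n X) (s : H0 n L) : Γ n L :=
  if hs : s ≠ 0 then phase (δ (Projectivization.mk ℂ s hs)) s.1 else 0

lemma onSections_of_ne_zero {s : H0 n L} (hs : s ≠ 0) (x : X) :
    onSections δ s x = δ (Projectivization.mk ℂ s hs) x := dif_pos hs

lemma onSections_smul (s : H0 n L) {c : ℂ} (hc : c ≠ 0) (x : X) :
    onSections δ (c • s) x = onSections δ s x := by
  by_cases hs : s = 0
  · rw [hs, smul_zero]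
  · have hcs : c • s ≠ 0 := smul_ne_zero hc hs
    rw [onSections_of_ne_zero hs, onSections_of_ne_zero hcs]
    congr 2
    exact (Projectivization.mk_eq_mk_iff' ℂ _ _ hcs hs).2 ⟨c, rfl⟩

lemma deformedSection_apply (s : H0 n L) (x : X) :
    (deformedSection δ s).1 x = Complex.exp (Complex.I * (onSections δ s x : ℂ)) • s.1.1 x := by
  by_cases hs : s = 0
  · subst hs
    rw [deformedSection, dif_neg (not_not.2 rfl)]
    exact (smul_zero _).symm
  · rw [deformedSection, dif_pos hs, onSections_of_ne_zero hs]
    rfl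

lemma deformedSection_of_ne_zero {s : H0 n L} (hs : s ≠ 0) :
    deformedSection δ s = phase (δ (Projectivization.mk ℂ s hs)) s.1 := dif_pos hs

lemma deformedSection_ne_zero {s : H0 n L} (hs : s ≠ 0) : deformedSection δ s ≠ 0 := by
  rw [deformedSection_of_ne_zero hs]
  exact fun h => hs (Subtype.ext (phase_injective _ (h.trans (map_zero _).symm)))

/-- Since `δ` depends only on the line of `s`, the deformation is homogeneous of degree one and
descends to projective spaces. -/
lemma deformedSection_smul (s : H0 n L) {c : ℂ} (hc : c ≠ 0) :
    deformedSection δ (c • s) = c • deformedSection δ s := by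
  ext x
  change (deformedSection δ (c • s)).1 x = c • (deformedSection δ s).1 x
  rw [deformedSection_apply, deformedSection_apply, onSections_smul s hc]
  exact smul_comm _ _ _

lemma mem_deformedSystem {p : ℙ ℂ (Γ n L)} :
    p ∈ deformedSystem δ ↔ ∃ (s : H0 n L) (hs : s ≠ 0),
      Projectivization.mk ℂ (deformedSection δ s) (deformedSection_ne_zero hs) = p := by
  have key : ∀ (s : H0 n L) (hs : s ≠ 0), projPhase (δ (Projectivization.mk ℂ s hs))
      (Projectivization.map (holoSections n L).subtype (holoSections n L).injective_subtype
        (Projectivization.mk ℂ s hs)) =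
      Projectivization.mk ℂ (deformedSection δ s) (deformedSection_ne_zero hs) := by
    intro s hs
    rw [Projectivization.map_mk, projPhase, Projectivization.map_mk]
    congr 1
    exact (deformedSection_of_ne_zero hs).symm
  constructor
  · rintro ⟨q, rfl⟩
    induction q using Projectivization.ind with
    | h s hs => exact ⟨s, hs, (key s hs).symm⟩
  · rintro ⟨s, hs, rfl⟩
    exact ⟨Projectivization.mk ℂ s hs, key s hs⟩

lemma norm_exp_I_mul (a : ℝ) : ‖Complex.exp (Complex.I * (a : ℂ))‖ = 1 := by
  rw [mul_comm, Complex.norm_exp_ofReal_mul_I]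

/-- The derivative of a deformation at `[s]` in the direction of `v`. -/
noncomputable def dirDeriv (δ : ℙ ℂ (H0 n L) → SmoothFun n X) (s v : H0 n L) (x : X) : ℝ :=
  deriv (fun t : ℝ => onSections δ (s + (t : ℂ) • v) x) 0

variable {N : ℕ} (β : Module.Basis (Fin N) ℂ (H0 n L))

lemma contMDiffOn_onSections (hδ : IsSmoothDeformation δ) :
    ContMDiffOn (𝓘(ℝ, Fin N → ℂ).prod 𝓘(ℝ, Model n)) 𝓘(ℝ, ℝ) ∞
      (fun q : (Fin N → ℂ) × X => onSections δ (β.equivFun.symm q.1) q.2)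
      {q | β.equivFun.symm q.1 ≠ 0} := by
  have := hδ N β
  simpa only [Module.Basis.equivFun_symm_apply] using this

lemma differentiableAt_onSections (hδ : IsSmoothDeformation δ) {c : Fin N → ℂ} (hc : c ≠ 0)
    (x : X) : DifferentiableAt ℝ (fun c => onSections δ (β.equivFun.symm c) x) c := by
  have hopen : IsOpen {c : Fin N → ℂ | c ≠ 0} := isOpen_ne
  have hne : ∀ c : Fin N → ℂ, c ≠ 0 → β.equivFun.symm c ≠ 0 := fun c hc =>
    (LinearEquiv.map_ne_zero_iff _).2 hc
  have h1 : ContMDiffOn 𝓘(ℝ, Fin N → ℂ) (𝓘(ℝ, Fin N → ℂ).prod 𝓘(ℝ, Model n)) ∞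
      (fun c : Fin N → ℂ => (c, x)) {c : Fin N → ℂ | c ≠ 0} :=
    contMDiffOn_id.prodMk contMDiffOn_const
  have h2 := (contMDiffOn_onSections β hδ).comp h1 fun c hc => hne c hc
  exact (h2.contDiffOn.contDiffAt (hopen.mem_nhds hc)).differentiableAt (by simp)

/-- Directional derivatives come from a total derivative in homogeneous coordinates, which makes
them additive in the direction. -/
lemma dirDeriv_eq_fderiv (hδ : IsSmoothDeformation δ) {c : Fin N → ℂ} (hc : c ≠ 0)
    (w : Fin N → ℂ) (x : X) : dirDeriv δ (β.equivFun.symm c) (β.equivFun.symm w) x =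
      fderiv ℝ (fun c => onSections δ (β.equivFun.symm c) x) c w := by
  have h1 := (differentiableAt_onSections β hδ hc x).hasFDerivAt
  have h2 : HasDerivAt (fun t : ℝ => c + t • w) w 0 := by
    simpa using ((hasDerivAt_id (0 : ℝ)).smul_const w).const_add c
  have h1' : HasFDerivAt (fun c => onSections δ (β.equivFun.symm c) x)
      (fderiv ℝ (fun c => onSections δ (β.equivFun.symm c) x) c) (c + (0 : ℝ) • w) := by
    simpa using h1
  have h3 := h1'.comp_hasDerivAt (0 : ℝ) h2
  rw [dirDeriv, ← h3.deriv]
  congr 1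
  ext t
  simp only [Function.comp_apply, map_add]
  rw [← Complex.coe_smul, map_smul]

/-- This is the Leibniz rule. The phase is factored out because it cancels in hermitian products and
in quotients by the deformed section itself. -/
lemma famDeriv_deformedSection (hδ : IsSmoothDeformation δ) {k : ℕ} {c₀ : Fin N → ℂ}
    (A : EuclideanSpace ℝ (Fin k) →L[ℝ] (Fin N → ℂ)) {b : EuclideanSpace ℝ (Fin k)}
    (hb : c₀ + A b ≠ 0) (ξ : EuclideanSpace ℝ (Fin k)) (x : X) :
    famDeriv (fun b => deformedSection δ (β.equivFun.symm (c₀ + A b))) b ξ x =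
      Complex.exp (Complex.I * (onSections δ (β.equivFun.symm (c₀ + A b)) x : ℂ)) •
        ((Complex.I * (dirDeriv δ (β.equivFun.symm (c₀ + A b)) (β.equivFun.symm (A ξ)) x : ℂ)) •
          (β.equivFun.symm (c₀ + A b)).1.1 x + (β.equivFun.symm (A ξ)).1.1 x) := by
  have hx := mem_baseSet_trivializationAt ℂ L x
  let ev : H0 n L →ₗ[ℂ] ℂ := (LinearMap.proj x ∘ₗ evalCoord n L) ∘ₗ (holoSections n L).subtype
  let κ : (Fin N → ℂ) →L[ℂ] ℂ := (ev ∘ₗ β.equivFun.symm.toLinearMap).toContinuousLinearMap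
  have hκ : ∀ c, κ c = coord L x x ((β.equivFun.symm c).1.1 x) := fun _ => rfl
  have hline : HasFDerivAt (fun b => c₀ + A b) A b := A.hasFDerivAt.const_add c₀
  have h1 := (differentiableAt_onSections β hδ hb x).hasFDerivAt.comp b hline
  have h2 := ((Complex.ofRealCLM.hasFDerivAt.comp b h1).const_mul Complex.I).cexp
  have h3 := ((κ.restrictScalars ℝ).hasFDerivAt (x := c₀ + A b)).comp b hline
  have h4 := h2.mul h3
  have heq : (fun b => (trivializationAt ℂ L x
      ⟨x, (deformedSection δ (β.equivFun.symm (c₀ + A b))).1 x⟩).2) =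
      fun b => Complex.exp (Complex.I * (onSections δ (β.equivFun.symm (c₀ + A b)) x : ℂ)) *
        κ (c₀ + A b) := by
    ext b
    rw [← coord_apply hx, deformedSection_apply, map_smul, smul_eq_mul, hκ]
  rw [famDeriv, heq]
  apply coord_injective hx
  rw [coord_symm hx, dirDeriv_eq_fderiv β hδ hb, (coord L x x).map_smul, (coord L x x).map_add,
    (coord L x x).map_smul, ← hκ, ← hκ]
  have h5 := congrArg (fun f => f ξ) h4.fderiv
  refine h5.trans ?_
  simp only [add_apply, smul_apply,
    ContinuousLinearMap.comp_apply, Function.comp_apply, Complex.ofRealCLM_apply, smul_eq_mul,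
    ContinuousLinearMap.coe_restrictScalars']
  ring

variable [IsManifold 𝓘(ℂ, Model n) ω X] [ContMDiffVectorBundle ω ℂ L 𝓘(ℂ, Model n)]
  [PreconnectedSpace X]

/-- Distinct points of the linear system have distinct deformations. -/
lemma exists_eq_smul_of_deformedSection_eq_smul {s t : H0 n L} (ht : t ≠ 0) {c : ℂ}
    (h : deformedSection δ s = c • deformedSection δ t) : ∃ c' : ℂ, s = c' • t := by
  -- Phases have modulus one, so `s / t` takes its values on the circle of radius `‖c‖`.
  refine exists_eq_smul_of_forall_eq_smul (S := Metric.sphere 0 ‖c‖)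
    (u := fun x => (Complex.exp (Complex.I * (onSections δ s x : ℂ)))⁻¹ *
      (c * Complex.exp (Complex.I * (onSections δ t x : ℂ)))) (interior_sphere' _ _)
    (fun x => ?_) (fun x => ?_) ht
  · rw [mem_sphere_zero_iff_norm, norm_mul, norm_inv, norm_mul, norm_exp_I_mul, norm_exp_I_mul,
      inv_one, one_mul, mul_one]
  · have h1 : (deformedSection δ s).1 x = c • (deformedSection δ t).1 x :=
      congrFun (congrArg Subtype.val h) x
    rw [deformedSection_apply, deformedSection_apply] at h1
    rw [mul_smul, mul_smul, ← h1, smul_smul, inv_mul_cancel₀ (Complex.exp_ne_zero _), one_smul]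

end Deformation

/-! ### The deformed linear system is a submanifold -/

section Submanifold

variable {n : ℕ} {X : Type*} [TopologicalSpace X] [ChartedSpace (Model n) X]
variable {L : X → Type*} [∀ x, AddCommGroup (L x)] [∀ x, Module ℂ (L x)]
  [TopologicalSpace (TotalSpace ℂ L)] [∀ x, TopologicalSpace (L x)] [FiberBundle ℂ L]
  [VectorBundle ℂ ℂ L] {δ : ℙ ℂ (H0 n L) → SmoothFun n X}
  {N : ℕ} (β : Module.Basis (Fin N) ℂ (H0 n L)) {c₀ : Fin N → ℂ}

lemma contMDiff_deformedSection (hδ : IsSmoothDeformation δ) {k : ℕ}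
    (A : EuclideanSpace ℝ (Fin k) →L[ℝ] (Fin N → ℂ)) (hA : ∀ b, c₀ + A b ≠ 0) :
    ContMDiff (𝓘(ℝ, EuclideanSpace ℝ (Fin k)).prod 𝓘(ℝ, Model n))
      (𝓘(ℝ, Model n).prod 𝓘(ℝ, ℂ)) ∞
      (fun q : EuclideanSpace ℝ (Fin k) × X => TotalSpace.mk' ℂ q.2
        ((deformedSection δ (β.equivFun.symm (c₀ + A q.1))).1 q.2)) := by
  rintro ⟨b, x⟩
  refine contMDiffAt_totalSpace.2 ⟨contMDiffAt_snd, ?_⟩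
  have hcoord : ContMDiff (𝓘(ℝ, EuclideanSpace ℝ (Fin k)).prod 𝓘(ℝ, Model n))
      𝓘(ℝ, Fin N → ℂ) ∞ (fun q : EuclideanSpace ℝ (Fin k) × X => c₀ + A q.1) := by
    have h1 : ContDiff ℝ ∞ (fun b => c₀ + A b) := contDiff_const.add A.contDiff
    exact h1.contMDiff.comp contMDiff_fst
  have hF : ContMDiff (𝓘(ℝ, EuclideanSpace ℝ (Fin k)).prod 𝓘(ℝ, Model n)) 𝓘(ℝ, ℝ) ∞
      (fun q : EuclideanSpace ℝ (Fin k) × X =>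
        onSections δ (β.equivFun.symm (c₀ + A q.1)) q.2) := by
    rw [← contMDiffOn_univ]
    refine (contMDiffOn_onSections β hδ).comp (f := fun q : EuclideanSpace ℝ (Fin k) × X =>
      (c₀ + A q.1, q.2)) (hcoord.prodMk contMDiff_snd).contMDiffOn fun q _ => ?_
    exact (LinearEquiv.map_ne_zero_iff _).2 (hA q.1)
  have hexp : ContDiff ℝ ∞ (fun t : ℝ => Complex.exp (Complex.I * (t : ℂ))) :=
    (contDiff_const.mul Complex.ofRealCLM.contDiff).cexp
  have hE := (hexp.contMDiff.comp hF).contMDiffAt (x := (b, x))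
  have hmul : ContDiff ℝ ∞ (fun p : ℂ × ℂ => p.1 * p.2) := contDiff_fst.mul contDiff_snd
  -- Joint smoothness in the parameter and the point follows by expanding in the basis: each term is
  -- a coordinate of the parameter times a fixed smooth section.
  have hterm : ∀ i : Fin N, ContMDiffAt (𝓘(ℝ, EuclideanSpace ℝ (Fin k)).prod 𝓘(ℝ, Model n))
      𝓘(ℝ, ℂ) ∞ (fun q : EuclideanSpace ℝ (Fin k) × X => (c₀ + A q.1) i *
        (trivializationAt ℂ L x ⟨q.2, (β i).1.1 q.2⟩).2) (b, x) := by
    intro i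
    have h1 : ContMDiffAt (𝓘(ℝ, EuclideanSpace ℝ (Fin k)).prod 𝓘(ℝ, Model n)) 𝓘(ℝ, ℂ) ∞
        (fun q : EuclideanSpace ℝ (Fin k) × X => (c₀ + A q.1) i) (b, x) := by
      have h2 : ContDiff ℝ ∞ (fun c : Fin N → ℂ => c i) := contDiff_apply ℝ ℂ i
      exact (h2.contMDiff.comp hcoord) _
    have h3 := (contMDiffAt_section (n := ∞) x).1 ((β i).1.2 x)
    have h4 : ContMDiffAt (𝓘(ℝ, EuclideanSpace ℝ (Fin k)).prod 𝓘(ℝ, Model n)) 𝓘(ℝ, ℂ) ∞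
        (fun q : EuclideanSpace ℝ (Fin k) × X =>
          (trivializationAt ℂ L x ⟨q.2, (β i).1.1 q.2⟩).2) (b, x) :=
      ContMDiffAt.comp (g := fun y => (trivializationAt ℂ L x ⟨y, (β i).1.1 y⟩).2) (b, x) h3
        contMDiffAt_snd
    exact hmul.contMDiff.contMDiffAt.comp (b, x) (h1.prodMk_space h4)
  have hsum := contMDiffAt_finsetSum (t := Finset.univ) (fun i _ => hterm i)
  have hprod := hmul.contMDiff.contMDiffAt.comp (b, x) (hE.prodMk_space hsum)
  refine hprod.congr_of_eventuallyEq ?_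
  have hbase : ∀ᶠ q : EuclideanSpace ℝ (Fin k) × X in 𝓝 (b, x),
      q.2 ∈ (trivializationAt ℂ L x).baseSet :=
    continuous_snd.continuousAt.eventually_mem ((trivializationAt ℂ L x).open_baseSet.mem_nhds
      (mem_baseSet_trivializationAt ℂ L x))
  filter_upwards [hbase] with q hq
  change (trivializationAt ℂ L x ⟨q.2, _⟩).2 = _
  rw [← coord_apply hq, deformedSection_apply, map_smul, smul_eq_mul]
  simp only [Function.comp_apply]
  congr 1
  let ev : H0 n L →ₗ[ℂ] ℂ := coord L x q.2 ∘ₗ LinearMap.proj q.2 ∘ₗ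
    (smoothSections n L).subtype ∘ₗ (holoSections n L).subtype
  change ev _ = _
  rw [Module.Basis.equivFun_symm_apply, map_sum]
  refine Finset.sum_congr rfl fun i _ => ?_
  rw [map_smul, smul_eq_mul, ← coord_apply hq]
  rfl

variable [IsManifold 𝓘(ℂ, Model n) ω X] [ContMDiffVectorBundle ω ℂ L 𝓘(ℂ, Model n)]
  [PreconnectedSpace X]

/-- Cancelling the phase, the quotient of the direction by the section is `c - i dδ`. Its real part
is constant since `dδ` is real, so it takes its values on a vertical line and must be constant. -/
lemma eq_zero_of_famDeriv_eq_smul (hδ : IsSmoothDeformation δ) {k : ℕ}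
    {A : EuclideanSpace ℝ (Fin k) →L[ℝ] (Fin N → ℂ)} {l : (Fin N → ℂ) →L[ℂ] ℂ}
    (hlc : l c₀ = 1) (hlA : ∀ b, l (A b) = 0) (hinj : Function.Injective A)
    {b ξ : EuclideanSpace ℝ (Fin k)} (hb : c₀ + A b ≠ 0) {c : ℂ}
    (h : famDeriv (fun b => deformedSection δ (β.equivFun.symm (c₀ + A b))) b ξ =
      c • (deformedSection δ (β.equivFun.symm (c₀ + A b))).1) : ξ = 0 := by
  have hS : interior (Complex.re ⁻¹' {c.re}) = ∅ := by
    rw [Complex.interior_preimage_re, interior_singleton, preimage_empty]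
  obtain ⟨c', hc'⟩ := exists_eq_smul_of_forall_eq_smul (s := β.equivFun.symm (A ξ))
    (t := β.equivFun.symm (c₀ + A b)) hS
    (u := fun x => c - Complex.I *
      (dirDeriv δ (β.equivFun.symm (c₀ + A b)) (β.equivFun.symm (A ξ)) x : ℂ))
    (fun x => by simp) (fun x => by
      have h1 := congrFun h x
      rw [famDeriv_deformedSection β hδ A hb] at h1
      have h2 : (c • (deformedSection δ (β.equivFun.symm (c₀ + A b))).1) x =
          Complex.exp (Complex.I * (onSections δ (β.equivFun.symm (c₀ + A b)) x : ℂ)) •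
            (c • (β.equivFun.symm (c₀ + A b)).1.1 x) := by
        rw [smul_comm, ← deformedSection_apply]
        rfl
      have h3 := smul_right_injective _ (Complex.exp_ne_zero _) (h1.trans h2)
      rw [sub_smul, ← h3]
      exact (add_sub_cancel_left _ _).symm) ((LinearEquiv.map_ne_zero_iff _).2 hb)
  rw [← map_smul] at hc'
  have h1 := β.equivFun.symm.injective hc'
  -- `l` vanishes on the direction and equals 1 on the base point, so the proportionality factor is
  -- zero.
  have h2 := congrArg l h1
  rw [hlA, map_smul, map_add, hlA, hlc, add_zero, smul_eq_mul, mul_one] at h2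
  rw [← h2, zero_smul] at h1
  exact hinj (h1.trans (map_zero A).symm)

/-- The affine charts of the linear system parametrize its deformation. -/
theorem isLocalParam_deformedSystem (hδ : IsSmoothDeformation δ) {k : ℕ}
    {A : EuclideanSpace ℝ (Fin k) →L[ℝ] (Fin N → ℂ)}
    {A' : (Fin N → ℂ) →L[ℝ] EuclideanSpace ℝ (Fin k)} {l : (Fin N → ℂ) →L[ℂ] ℂ}
    (hlc : l c₀ = 1) (hlA : ∀ b, l (A b) = 0) (hA' : ∀ b, A' (A b) = b)
    (hAA' : ∀ c, l c = 0 → A (A' c) = c) :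
    IsLocalParam (deformedSystem δ) univ
      (fun b => deformedSection δ (β.equivFun.symm (c₀ + A b))) := by
  have hlne : ∀ b, l (c₀ + A b) = 1 := fun b => by rw [map_add, hlA, hlc, add_zero]
  have hne : ∀ b, c₀ + A b ≠ 0 := fun b h => by
    have := hlne b
    rw [h, map_zero] at this
    exact zero_ne_one this
  have hinj : Function.Injective A := Function.LeftInverse.injective hA'
  have hTne : ∀ {c}, c ≠ 0 → β.equivFun.symm c ≠ 0 := fun hc =>
    (LinearEquiv.map_ne_zero_iff _).2 hc
  have hprop : ∀ {c c' : Fin N → ℂ} {z : ℂ}, c' ≠ 0 → deformedSection δ (β.equivFun.symm c) =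
      z • deformedSection δ (β.equivFun.symm c') → ∃ z' : ℂ, c = z' • c' := by
    intro c c' z hc' h
    obtain ⟨z', hz'⟩ := exists_eq_smul_of_deformedSection_eq_smul (hTne hc') h
    rw [← map_smul] at hz'
    exact ⟨z', β.equivFun.symm.injective hz'⟩
  refine ⟨isOpen_univ, fun b _ => deformedSection_ne_zero (hTne (hne b)),
    (contMDiff_deformedSection β hδ A hne).contMDiffOn, fun b _ ξ ⟨c, hc⟩ =>
      eq_zero_of_famDeriv_eq_smul β hδ hlc hlA hinj (hne b) hc, ?_, ?_⟩
  · rintro b - b' - ⟨z, hz⟩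
    obtain ⟨z', hz'⟩ := hprop (hne b') hz
    have h1 := congrArg l hz'
    rw [map_smul, hlne, hlne, smul_eq_mul, mul_one] at h1
    rw [← h1, one_smul] at hz'
    exact hinj (add_left_cancel hz')
  · intro V _ hV
    -- The cone of all nonzero multiples of the points `c₀ + A b` with `b ∈ V`. It is open because
    -- `A'` recovers `b` continuously after normalizing `l` to 1.
    set U : Set (Fin N → ℂ) := {c | l c ≠ 0} ∩ (fun c => A' ((l c)⁻¹ • c - c₀)) ⁻¹' V with hU
    have hUopen : IsOpen U := by
      refine ContinuousOn.isOpen_inter_preimage ?_ (isOpen_ne_fun l.continuous continuous_const) hV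
      exact A'.continuous.comp_continuousOn
        (((l.continuous.continuousOn.inv₀ fun c hc => hc).smul continuousOn_id).sub
          continuousOn_const)
    have hUmem : ∀ c, c ∈ U ↔ ∃ z : ℂ, z ≠ 0 ∧ ∃ b ∈ V, c = z • (c₀ + A b) := by
      intro c
      constructor
      · rintro ⟨hc, hcV⟩
        refine ⟨l c, hc, _, hcV, ?_⟩
        rw [hAA', add_sub_cancel, smul_smul, mul_inv_cancel₀ hc, one_smul]
        rw [map_sub, map_smul, hlc, smul_eq_mul, inv_mul_cancel₀ hc, sub_self]
      · rintro ⟨z, hz, b, hb, rfl⟩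
        have h1 : l (z • (c₀ + A b)) = z := by rw [map_smul, hlne, smul_eq_mul, mul_one]
        refine ⟨?_, ?_⟩
        · rw [mem_ofPred_eq, h1]
          exact hz
        · rw [mem_preimage, h1, smul_smul, inv_mul_cancel₀ hz, one_smul, add_sub_cancel_left, hA']
          exact hb
    -- Unit representatives of the points of the linear system outside the chart image of `V`. The
    -- required open set is the complement of the cone over their deformations.
    set K : Set (Fin N → ℂ) := Metric.sphere 0 1 ∩ Uᶜ with hK
    have hKc : IsCompact K := (isCompact_sphere 0 1).inter_right hUopen.isClosed_compl
    have hKne : ∀ c ∈ K, c ≠ 0 := fun c hc => by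
      have h1 : ‖c‖ = 1 := mem_sphere_zero_iff_norm.1 hc.1
      exact norm_ne_zero_iff.1 (by rw [h1]; exact one_ne_zero)
    set g : (Fin N → ℂ) → X → ℂ := fun c =>
      evalCoord n L (deformedSection δ (β.equivFun.symm c)) with hg
    have hgcont : ContinuousOn g K := by
      refine continuousOn_pi.2 fun x c hc => ContinuousAt.continuousWithinAt ?_
      have h1 := (differentiableAt_onSections β hδ (hKne c hc) x).continuousAt
      let κ : (Fin N → ℂ) →ₗ[ℂ] ℂ := (LinearMap.proj x ∘ₗ evalCoord n L) ∘ₗ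
        (holoSections n L).subtype ∘ₗ β.equivFun.symm.toLinearMap
      have h2 : Continuous κ := κ.continuous_of_finiteDimensional
      have h3 : ContinuousAt (fun c => Complex.exp
          (Complex.I * (onSections δ (β.equivFun.symm c) x : ℂ)) * κ c) c :=
        ((continuousAt_const.mul
          (Complex.continuous_ofReal.continuousAt.comp h1)).cexp).mul h2.continuousAt
      refine h3.congr (Filter.Eventually.of_forall fun c' => ?_)
      change _ = coord L x x ((deformedSection δ (β.equivFun.symm c')).1 x)
      rw [deformedSection_apply, map_smul, smul_eq_mul]
      rfl
    have hgne : ∀ c ∈ K, g c ≠ 0 := fun c hc h =>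
      deformedSection_ne_zero (δ := δ) (hTne (hKne c hc))
        (evalCoord_injective (h.trans (map_zero _).symm))
    refine ⟨_, isOpen_setOf_rep_notMem (isClosed_cone hKc hgcont hgne) ?_, ?_⟩
    · rintro a f ⟨c, hc, z, rfl⟩
      exact ⟨c, hc, a * z, smul_smul _ _ _⟩
    · ext p
      constructor
      · rintro ⟨b, hb, hb0, rfl⟩
        refine ⟨mem_deformedSystem.2 ⟨_, hTne (hne b), rfl⟩, ?_⟩
        -- A point of the image of `V` lying in the cone over `K` would have proportional
        -- deformations, hence proportional coordinates, putting `c` into `U`.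
        rintro ⟨c, hc, z, hz⟩
        obtain ⟨a, ha⟩ := Projectivization.exists_smul_eq_mk_rep ℂ _ hb0
        rw [← ha, Units.smul_def, hg, ← map_smul] at hz
        have h1 := evalCoord_injective hz
        have h2 : deformedSection δ (β.equivFun.symm (c₀ + A b)) =
            ((a : ℂ)⁻¹ * z) • deformedSection δ (β.equivFun.symm c) := by
          rw [mul_smul, ← h1, smul_smul, inv_mul_cancel₀ a.ne_zero, one_smul]
        obtain ⟨z', hz'⟩ := hprop (hKne c hc) h2
        have hz0 : z' ≠ 0 := by
          rintro rfl
          exact hne b (by rw [hz', zero_smul])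
        exact hc.2 ((hUmem c).2 ⟨z'⁻¹, inv_ne_zero hz0, b, hb, by
          rw [hz', smul_smul, inv_mul_cancel₀ hz0, one_smul]⟩)
      · rintro ⟨hp, hpW⟩
        obtain ⟨s, hs, rfl⟩ := mem_deformedSystem.1 hp
        set c : Fin N → ℂ := β.equivFun s with hc
        have hc0 : c ≠ 0 := (LinearEquiv.map_ne_zero_iff _).2 hs
        have hsc : s = β.equivFun.symm c := (β.equivFun.symm_apply_apply s).symm
        have hr : ((‖c‖ : ℂ))⁻¹ ≠ 0 :=
          inv_ne_zero (Complex.ofReal_ne_zero.2 (norm_ne_zero_iff.2 hc0))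
        -- If the normalized coordinates were not in `U`, they would lie in `K`, and `p` would lie
        -- in the excluded cone.
        have hcU : ((‖c‖ : ℂ))⁻¹ • c ∈ U := by
          by_contra hnot
          refine hpW ?_
          obtain ⟨a, ha⟩ := Projectivization.exists_smul_eq_mk_rep ℂ _
            (deformedSection_ne_zero (δ := δ) hs)
          refine ⟨((‖c‖ : ℂ))⁻¹ • c, ⟨?_, hnot⟩, (a : ℂ) * (‖c‖ : ℂ), ?_⟩
          · rw [mem_sphere_zero_iff_norm, norm_smul, norm_inv, Complex.norm_real, norm_norm,
              inv_mul_cancel₀ (norm_ne_zero_iff.2 hc0)]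
          · rw [← ha, Units.smul_def, hg]
            simp only
            rw [map_smul (β.equivFun.symm), ← hsc, deformedSection_smul s hr, map_smul, map_smul,
              smul_smul, mul_assoc,
              mul_inv_cancel₀ (Complex.ofReal_ne_zero.2 (norm_ne_zero_iff.2 hc0)), mul_one]
        obtain ⟨z, hz, b, hb, hzb⟩ := (hUmem _).1 hcU
        refine ⟨b, hb, deformedSection_ne_zero (hTne (hne b)), ?_⟩
        have hw : (z⁻¹ * ((‖c‖ : ℂ))⁻¹) ≠ 0 := mul_ne_zero (inv_ne_zero hz) hr
        have h1 : c₀ + A b = (z⁻¹ * ((‖c‖ : ℂ))⁻¹) • c := by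
          rw [mul_smul, hzb, smul_smul, inv_mul_cancel₀ hz, one_smul]
        refine (Projectivization.mk_eq_mk_iff' ℂ _ _ _ _).2 ⟨z⁻¹ * ((‖c‖ : ℂ))⁻¹, ?_⟩
        change _ = deformedSection δ (β.equivFun.symm (c₀ + A b))
        rw [h1, map_smul, ← hsc, deformedSection_smul s hw]

end Submanifold

/-! ### Second derivatives of holomorphic maps and the operator `ddᶜ` -/

section Ddc

variable {n : ℕ} {E F : Type*} [NormedAddCommGroup E] [NormedSpace ℂ E] [NormedAddCommGroup F]
  [NormedSpace ℂ F]

lemma fderiv_real_eventuallyEq {f : E → F} {y : E} (hf : ContDiffAt ℂ 2 f y) :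
    ∀ᶠ z in 𝓝 y, fderiv ℝ f z = (fderiv ℂ f z).restrictScalars ℝ := by
  filter_upwards [hf.eventually (by simp)] with z hz
  exact ((hz.differentiableAt (by simp)).hasFDerivAt.restrictScalars ℝ).fderiv

/-- The real second derivative of a holomorphic map is its complex one, hence complex bilinear. This
is what makes `ddᶜ` blind to holomorphic terms. -/
lemma hasFDerivAt_fderiv_real {f : E → F} {y : E} (hf : ContDiffAt ℂ 2 f y) :
    HasFDerivAt (fderiv ℝ f) ((ContinuousLinearMap.restrictScalarsL ℂ E F ℝ ℝ) ∘L
      (fderiv ℂ (fderiv ℂ f) y).restrictScalars ℝ) y := by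
  have h1 : HasFDerivAt (fderiv ℂ f) (fderiv ℂ (fderiv ℂ f) y) y :=
    ((hf.fderiv_right (m := 1) (by norm_num)).differentiableAt (by simp)).hasFDerivAt
  have h2 := ((ContinuousLinearMap.restrictScalarsL ℂ E F ℝ ℝ).hasFDerivAt
    (x := fderiv ℂ f y)).comp y (h1.restrictScalars ℝ)
  exact h2.congr_of_eventuallyEq (fderiv_real_eventuallyEq hf)

lemma fderiv_fderiv_swap {f : E → F} {y : E} (hf : ContDiffAt ℂ 2 f y) (ξ η : E) :
    fderiv ℂ (fderiv ℂ f) y ξ η = fderiv ℂ (fderiv ℂ f) y η ξ :=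
  hf.isSymmSndFDerivAt (by rw [minSmoothness_of_isRCLikeNormedField]) ξ η

/-- The second derivative of `ψ ∘ T + Re G`. -/
lemma fderiv_fderiv_comp_add_re {ψ : F → ℝ} {T : E → F} {G : E → ℂ} {Φ : E → ℝ} {y : E}
    (hψ : ContDiffAt ℝ 2 ψ (T y)) (hT : ContDiffAt ℂ 2 T y) (hG : ContDiffAt ℂ 2 G y)
    (hΦ : ∀ᶠ z in 𝓝 y, Φ z = ψ (T z) + (G z).re) (ξ η : E) :
    fderiv ℝ (fderiv ℝ Φ) y ξ η = fderiv ℝ (fderiv ℝ ψ) (T y) (fderiv ℂ T y ξ) (fderiv ℂ T y η)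
      + fderiv ℝ ψ (T y) (fderiv ℂ (fderiv ℂ T) y ξ η)
      + (fderiv ℂ (fderiv ℂ G) y ξ η).re := by
  have hTd : HasFDerivAt T ((fderiv ℂ T y).restrictScalars ℝ) y :=
    (hT.differentiableAt (by simp)).hasFDerivAt.restrictScalars ℝ
  have hfd : ∀ᶠ z in 𝓝 y, fderiv ℝ Φ z =
      (fderiv ℝ ψ (T z)) ∘L (fderiv ℝ T z) + Complex.reCLM ∘L (fderiv ℝ G z) := by
    have hψ' := hTd.continuousAt.eventually (hψ.eventually (by simp))
    filter_upwards [hΦ.eventually_nhds, hψ', hT.eventually (by simp), hG.eventually (by simp)]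
      with z hz h1 h2 h3
    have h4 := (h1.differentiableAt (by simp)).hasFDerivAt.comp z
      ((h2.restrict_scalars ℝ).differentiableAt (by simp)).hasFDerivAt
    have h5 := (Complex.reCLM.hasFDerivAt (x := G z)).comp z
      ((h3.restrict_scalars ℝ).differentiableAt (by simp)).hasFDerivAt
    exact ((h4.add h5).congr_of_eventuallyEq hz).fderiv
  have hψ2 : HasFDerivAt (fderiv ℝ ψ) (fderiv ℝ (fderiv ℝ ψ) (T y)) (T y) :=
    ((hψ.fderiv_right (m := 1) (by norm_num)).differentiableAt (by simp)).hasFDerivAt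
  have h1 := (hψ2.comp y hTd).clm_comp (hasFDerivAt_fderiv_real hT)
  have h2 := ((ContinuousLinearMap.compL ℝ E ℂ ℝ Complex.reCLM).hasFDerivAt
    (x := fderiv ℝ G y)).comp y (hasFDerivAt_fderiv_real hG)
  have h3 := ((h1.add h2).congr_of_eventuallyEq hfd).fderiv
  have hTy : fderiv ℝ T y = (fderiv ℂ T y).restrictScalars ℝ := hTd.fderiv
  rw [h3, hTy]
  simp [add_comm]

/-- `ddᶜ` is natural under holomorphic maps and annihilates real parts of holomorphic functions. -/
lemma ddc_comp_add_re {ψ : Model n → ℝ} {T : Model n → Model n} {G : Model n → ℂ}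
    {Φ : Model n → ℝ} {y : Model n}
    (hψ : ContDiffAt ℝ 2 ψ (T y)) (hT : ContDiffAt ℂ 2 T y) (hG : ContDiffAt ℂ 2 G y)
    (hΦ : ∀ᶠ z in 𝓝 y, Φ z = ψ (T z) + (G z).re) (ξ η : Model n) :
    ddc Φ y ξ η = ddc ψ (T y) (fderiv ℂ T y ξ) (fderiv ℂ T y η) := by
  rw [ddc, ddc, fderiv_fderiv_comp_add_re hψ hT hG hΦ, fderiv_fderiv_comp_add_re hψ hT hG hΦ]
  -- The terms containing second derivatives of `T` and `G` are complex bilinear and symmetric, so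
  -- `I` can be moved to the other argument and the two halves of `ddᶜ` cancel.
  simp only [map_smul]
  rw [fderiv_fderiv_swap hT η ξ, fderiv_fderiv_swap hG η ξ]
  ring

/-- `ddᶜ ψ` at a point as a real bilinear form. -/
noncomputable def ddcBilin (ψ : Model n → ℝ) (y : Model n) : LinearMap.BilinForm ℝ (Model n) :=
  LinearMap.mk₂ ℝ (ddc ψ y)
    (fun _ _ _ => by simp only [ddc, map_add, smul_add, add_apply]; ring)
    (fun c _ _ => by
      simp only [ddc, map_smul, smul_comm Complex.I c, smul_apply, smul_eq_mul]
      ring)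
    (fun _ _ _ => by simp only [ddc, map_add, smul_add, add_apply]; ring)
    (fun c _ _ => by
      simp only [ddc, map_smul, smul_comm Complex.I c, smul_apply, smul_eq_mul]
      ring)

/-- The pairing `(ξ, η) ↦ ddᶜ ψ (ξ, I η)` is symmetric. -/
lemma ddc_smul_I_symm {ψ : Model n → ℝ} {y : Model n} (hψ : ContDiffAt ℝ 2 ψ y)
    (ξ η : Model n) : ddc ψ y ξ (Complex.I • η) = ddc ψ y η (Complex.I • ξ) := by
  have hs : ∀ v w, fderiv ℝ (fderiv ℝ ψ) y v w = fderiv ℝ (fderiv ℝ ψ) y w v :=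
    hψ.isSymmSndFDerivAt (by rw [minSmoothness_of_isRCLikeNormedField])
  simp only [ddc, smul_smul, Complex.I_mul_I, neg_smul, one_smul, map_neg, neg_neg]
  rw [hs ξ η, hs (Complex.I • ξ)]

end Ddc

/-! ### The Kähler form in charts -/

section Kahler

variable {n : ℕ} {X : Type*} [TopologicalSpace X] [ChartedSpace (Model n) X]
  [IsManifold 𝓘(ℂ, Model n) ω X]

lemma contDiffAt_transition {φ φ' : OpenPartialHomeomorph X (Model n)}
    (hφ : φ ∈ atlas (Model n) X) (hφ' : φ' ∈ atlas (Model n) X) {y : Model n}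
    (hy : y ∈ φ.target) (hy' : φ.symm y ∈ φ'.source) :
    ContDiffAt ℂ ω (fun z => φ' (φ.symm z)) y := by
  have h1 := (contMDiffOn_symm_of_mem_maximalAtlas (I := 𝓘(ℂ, Model n)) (n := ω)
    (IsManifold.subset_maximalAtlas hφ)).contMDiffAt (φ.open_target.mem_nhds hy)
  have h2 := (contMDiffOn_of_mem_maximalAtlas (I := 𝓘(ℂ, Model n)) (n := ω)
    (IsManifold.subset_maximalAtlas hφ')).contMDiffAt (φ'.open_source.mem_nhds hy')
  exact (h2.comp y h1).contDiffAt

variable (n X) in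
lemma isManifold_real : IsManifold 𝓘(ℝ, Model n) ∞ X := by
  refine isManifold_of_contDiffOn _ _ _ fun e e' he he' => ?_
  intro y hy
  have hy1 : y ∈ (e.symm.trans e').source := hy.1
  rw [OpenPartialHomeomorph.trans_source] at hy1
  have h1 := contDiffAt_transition he he' hy1.1 hy1.2
  exact ((h1.restrict_scalars ℝ).of_le le_top).contDiffWithinAt

variable {L : X → Type*} [∀ x, AddCommGroup (L x)] [∀ x, Module ℂ (L x)]
  [TopologicalSpace (TotalSpace ℂ L)] [∀ x, TopologicalSpace (L x)] [FiberBundle ℂ L]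
  [VectorBundle ℂ ℂ L] [ContMDiffVectorBundle ω ℂ L 𝓘(ℂ, Model n)]

lemma contDiffAt_kahlerPotential (h : HermitianMetric n L) {φ : OpenPartialHomeomorph X (Model n)}
    (hφ : φ ∈ atlas (Model n) X) {y : Model n} (hy : y ∈ φ.target) {b : X}
    (hb : φ.symm y ∈ (trivializationAt ℂ L b).baseSet) :
    ContDiffAt ℝ ∞ (fun z => kahlerPotential h b (φ.symm z)) y := by
  have := isManifold_real n X
  have h1 := (contMDiffOn_symm_of_mem_maximalAtlas (I := 𝓘(ℝ, Model n)) (n := ∞)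
    (IsManifold.subset_maximalAtlas hφ)).contMDiffAt (φ.open_target.mem_nhds hy)
  have h2 := (h.smooth b).contMDiffAt ((trivializationAt ℂ L b).open_baseSet.mem_nhds hb)
  have h3 : ContDiffAt ℝ ∞ (fun z => frameSq h b (φ.symm z)) y := (h2.comp y h1).contDiffAt
  have h4 : frameSq h b (φ.symm y) ≠ 0 := (frameSq_pos h hb).ne'
  have h5 : Real.sqrt (frameSq h b (φ.symm y)) ≠ 0 := (Real.sqrt_pos.2 (frameSq_pos h hb)).ne'
  exact ((h3.sqrt h4).log h5).neg

lemma frameSq_change (h : HermitianMetric n L) {b b' x : X}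
    (hx' : x ∈ (trivializationAt ℂ L b').baseSet) :
    frameSq h b x = ‖coord L b' x ((trivializationAt ℂ L b).symm x (1 : ℂ))‖ ^ 2 *
      frameSq h b' x :=
  inner_self_re_eq h hx' _

/-- Two Kähler potentials differ by a coordinate change and the real part of a holomorphic
function. -/
lemma exists_kahlerPotential_change (h : HermitianMetric n L)
    {φ φ' : OpenPartialHomeomorph X (Model n)} (hφ : φ ∈ atlas (Model n) X) {y : Model n}
    (hy : y ∈ φ.target) (hy' : φ.symm y ∈ φ'.source) {b b' : X}
    (hb : φ.symm y ∈ (trivializationAt ℂ L b).baseSet)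
    (hb' : φ.symm y ∈ (trivializationAt ℂ L b').baseSet) :
    ∃ G : Model n → ℂ, ContDiffAt ℂ 2 G y ∧ ∀ᶠ z in 𝓝 y, kahlerPotential h b (φ.symm z) =
      kahlerPotential h b' (φ'.symm (φ' (φ.symm z))) + (G z).re := by
  -- The transition function of the bundle: the two potentials differ by `-ln |g|`.
  set g : Model n → ℂ := fun z =>
    coord L b' (φ.symm z) ((trivializationAt ℂ L b).symm (φ.symm z) (1 : ℂ)) with hg
  have hev : ∀ᶠ z in 𝓝 y, φ.symm z ∈ φ'.source ∧ φ.symm z ∈ (trivializationAt ℂ L b).baseSet ∧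
      φ.symm z ∈ (trivializationAt ℂ L b').baseSet := by
    have hc := φ.continuousAt_symm hy
    filter_upwards [hc.eventually_mem (φ'.open_source.mem_nhds hy'),
      hc.eventually_mem ((trivializationAt ℂ L b).open_baseSet.mem_nhds hb),
      hc.eventually_mem ((trivializationAt ℂ L b').open_baseSet.mem_nhds hb')] with z h1 h2 h3
    exact ⟨h1, h2, h3⟩
  have hgd : ContDiffAt ℂ ω g y := by
    have h1 := (contMDiffOn_symm_of_mem_maximalAtlas (I := 𝓘(ℂ, Model n)) (n := ω)
      (IsManifold.subset_maximalAtlas hφ)).contMDiffAt (φ.open_target.mem_nhds hy)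
    have h2 := (contMDiffOn_coordChangeL (n := ω) (IB := 𝓘(ℂ, Model n)) (𝕜 := ℂ)
      (trivializationAt ℂ L b) (trivializationAt ℂ L b')).contMDiffAt
      (((trivializationAt ℂ L b).open_baseSet.inter
        (trivializationAt ℂ L b').open_baseSet).mem_nhds ⟨hb, hb'⟩)
    have h3 : ContDiffAt ℂ ω (fun z => ((trivializationAt ℂ L b).coordChangeL ℂ
      (trivializationAt ℂ L b') (φ.symm z) : ℂ →L[ℂ] ℂ)) y :=
        (ContMDiffAt.comp (g := fun x => ((trivializationAt ℂ L b).coordChangeL ℂ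
      (trivializationAt ℂ L b') x : ℂ →L[ℂ] ℂ)) y h2 h1).contDiffAt
    have h4 := h3.clm_apply (contDiffAt_const (c := (1 : ℂ)))
    refine h4.congr_of_eventuallyEq ?_
    filter_upwards [hev] with z hz
    exact (coord_apply hz.2.2 _).trans
      (Bundle.Trivialization.coordChangeL_apply _ _ ⟨hz.2.1, hz.2.2⟩ _).symm
  have hg0 : ∀ z, φ.symm z ∈ (trivializationAt ℂ L b).baseSet →
      φ.symm z ∈ (trivializationAt ℂ L b').baseSet → g z ≠ 0 := by
    intro z h1 h2 h0
    have h3 := frameSq_change h (b := b) h2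
    have h4 := frameSq_pos h h1
    rw [hg] at h0
    simp only at h0
    rw [h3, h0, norm_zero] at h4
    norm_num at h4
  have hgy := hg0 y hb hb'
  -- Dividing by `g y` moves the argument near 1, where the logarithm is holomorphic. The added
  -- constant restores the real part.
  refine ⟨fun z => -(Complex.log (g z / g y) + (Real.log ‖g y‖ : ℂ)), ?_, ?_⟩
  · have h1 : ContDiffAt ℂ 2 (fun z => g z / g y) y :=
      (hgd.of_le le_top).div_const _
    have h2 : ContDiffAt ℂ 2 Complex.log (g y / g y) := Complex.contDiffAt_log (by
      rw [div_self hgy]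
      exact Complex.one_mem_slitPlane)
    exact ((h2.comp y h1).add contDiffAt_const).neg
  · filter_upwards [hev] with z hz
    have hgz := hg0 z hz.2.1 hz.2.2
    rw [φ'.left_inv hz.1, Complex.neg_re, Complex.add_re, Complex.log_re, Complex.ofReal_re,
      norm_div, Real.log_div (norm_ne_zero_iff.2 hgz) (norm_ne_zero_iff.2 hgy)]
    change -Real.log (Real.sqrt (frameSq h b (φ.symm z))) =
      -Real.log (Real.sqrt (frameSq h b' (φ.symm z))) + _
    rw [frameSq_change h hz.2.2, Real.sqrt_mul (sq_nonneg _), Real.sqrt_sq (norm_nonneg _),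
      Real.log_mul (norm_ne_zero_iff.2 hgz) (Real.sqrt_pos.2 (frameSq_pos h hz.2.2)).ne']
    ring

/-- The Kähler form does not depend on the chart and on the local frame. -/
lemma kahlerForm_eq_ddc (h : HermitianMetric n L) {φ φ' : OpenPartialHomeomorph X (Model n)}
    (hφ : φ ∈ atlas (Model n) X) (hφ' : φ' ∈ atlas (Model n) X) {y : Model n} (hy : y ∈ φ.target)
    (hy' : φ.symm y ∈ φ'.source) {b : X} (hb : φ.symm y ∈ (trivializationAt ℂ L b).baseSet)
    (ξ η : Model n) :
    kahlerForm h φ y ξ η = (1 / (2 * Real.pi)) *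
      ddc (fun z => kahlerPotential h b (φ'.symm z)) (φ' (φ.symm y))
        (fderiv ℂ (fun z => φ' (φ.symm z)) y ξ) (fderiv ℂ (fun z => φ' (φ.symm z)) y η) := by
  obtain ⟨G, hG, hGe⟩ := exists_kahlerPotential_change h hφ hy hy'
    (mem_baseSet_trivializationAt ℂ L (φ.symm y)) hb
  rw [kahlerForm, ddc_comp_add_re (ψ := fun z => kahlerPotential h b (φ'.symm z))
    (T := fun z => φ' (φ.symm z)) ?_ ((contDiffAt_transition hφ hφ' hy hy').of_le le_top) hG hGe]
  refine (contDiffAt_kahlerPotential h hφ' (φ'.map_source hy') ?_).of_le ENat.LEInfty.out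
  rwa [φ'.left_inv hy']

lemma kahlerForm_transition (h : HermitianMetric n L) {φ φ' : OpenPartialHomeomorph X (Model n)}
    (hφ : φ ∈ atlas (Model n) X) (hφ' : φ' ∈ atlas (Model n) X) {y : Model n} (hy : y ∈ φ.target)
    (hy' : φ.symm y ∈ φ'.source) (ξ η : Model n) :
    kahlerForm h φ y ξ η = kahlerForm h φ' (φ' (φ.symm y))
        (fderiv ℂ (fun z => φ' (φ.symm z)) y ξ) (fderiv ℂ (fun z => φ' (φ.symm z)) y η) := by
  rw [kahlerForm_eq_ddc h hφ hφ' hy hy' (mem_baseSet_trivializationAt ℂ L _), kahlerForm,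
    φ'.left_inv hy']

/-- In `kahlerForm` the frame changes with the point of evaluation. With one frame fixed near a
point, continuity becomes visible. -/
lemma kahlerForm_eq_ddc_frame (h : HermitianMetric n L) {φ : OpenPartialHomeomorph X (Model n)}
    (hφ : φ ∈ atlas (Model n) X) {y : Model n} (hy : y ∈ φ.target) {b : X}
    (hb : φ.symm y ∈ (trivializationAt ℂ L b).baseSet) (ξ η : Model n) :
    kahlerForm h φ y ξ η = (1 / (2 * Real.pi)) *
      ddc (fun z => kahlerPotential h b (φ.symm z)) y ξ η := by
  have hid : (fun z => φ (φ.symm z)) =ᶠ[𝓝 y] id := by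
    filter_upwards [φ.open_target.mem_nhds hy] with z hz using φ.right_inv hz
  rw [kahlerForm_eq_ddc h hφ hφ hy (φ.map_target hy) hb, hid.fderiv_eq, fderiv_id, φ.right_inv hy]
  rfl

lemma continuousOn_kahlerForm (h : HermitianMetric n L) {φ : OpenPartialHomeomorph X (Model n)}
    (hφ : φ ∈ atlas (Model n) X) (ξ η : Model n) :
    ContinuousOn (fun y => kahlerForm h φ y ξ η) φ.target := by
  intro y hy
  have hb := mem_baseSet_trivializationAt ℂ L (φ.symm y)
  have h1 := contDiffAt_kahlerPotential h hφ hy hb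
  have h2 : ContDiffAt ℝ 0
      (fderiv ℝ (fderiv ℝ fun z => kahlerPotential h (φ.symm y) (φ.symm z))) y :=
    (h1.fderiv_right (m := 1) (by rw [one_add_one_eq_two]; exact ENat.LEInfty.out)).fderiv_right
      (m := 0) (by norm_num)
  have h3 : ∀ v w, ContinuousAt (fun z =>
      fderiv ℝ (fderiv ℝ fun z => kahlerPotential h (φ.symm y) (φ.symm z)) z v w) y :=
    fun v w => (h2.continuousAt.clm_apply continuousAt_const).clm_apply continuousAt_const
  have h4 : ContinuousAt (fun z => (1 / (2 * Real.pi)) *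
      ddc (fun z => kahlerPotential h (φ.symm y) (φ.symm z)) z ξ η) y :=
    continuousAt_const.mul ((h3 _ _).neg.add (h3 _ _))
  refine (h4.congr ?_).continuousWithinAt
  filter_upwards [φ.open_target.mem_nhds hy, (φ.continuousAt_symm hy).eventually_mem
    ((trivializationAt ℂ L (φ.symm y)).open_baseSet.mem_nhds hb)] with z hz hzb
  exact (kahlerForm_eq_ddc_frame h hφ hz hzb ξ η).symm

end Kahler

/-! ### The Liouville density -/

/-- The basis `realFrame` of `ℂⁿ` over `ℝ`. -/
noncomputable def realBasis (n : ℕ) : Module.Basis (Fin n ⊕ Fin n) ℝ (Model n) :=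
  Module.Basis.ofEquivFun
    { toFun := fun v => Sum.elim (fun j => (v j).re) (fun j => (v j).im)
      invFun := fun f j => (f (Sum.inl j) : ℂ) + (f (Sum.inr j) : ℂ) * Complex.I
      map_add' := fun v w => by ext (j | j) <;> simp
      map_smul' := fun c v => by ext (j | j) <;> simp
      left_inv := fun v => by ext j; simp
      right_inv := fun f => by ext (j | j) <;> simp }

lemma realBasis_apply (n : ℕ) (i : Fin n ⊕ Fin n) : realBasis n i = realFrame n i := by
  rw [realBasis, Module.Basis.coe_ofEquivFun]
  ext j
  rcases i with i | i
  · by_cases h : j = i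
    · subst h; simp [realFrame]
    · simp [realFrame, h]
  · by_cases h : j = i
    · subst h; simp [realFrame]
    · simp [realFrame, h]

/-- Multiplication by the imaginary unit is the square of multiplication by an eighth root of
unity, so its real determinant is positive. -/
lemma det_smul_I_pos (n : ℕ) :
    0 < LinearMap.det (DistribSMul.toLinearMap ℝ (Model n) Complex.I) := by
  set z : ℂ := Complex.exp ((Real.pi / 4 : ℝ) * Complex.I) with hz
  have hzz : z * z = Complex.I := by
    rw [hz, ← Complex.exp_add, ← add_mul, ← Complex.ofReal_add,
      show Real.pi / 4 + Real.pi / 4 = Real.pi / 2 by ring]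
    push_cast
    exact Complex.exp_pi_div_two_mul_I
  have h1 : DistribSMul.toLinearMap ℝ (Model n) Complex.I =
      DistribSMul.toLinearMap ℝ (Model n) z * DistribSMul.toLinearMap ℝ (Model n) z := by
    refine LinearMap.ext fun v => ?_
    change Complex.I • v = z • z • v
    rw [smul_smul, hzz]
  have h2 : DistribSMul.toLinearMap ℝ (Model n) z⁻¹ * DistribSMul.toLinearMap ℝ (Model n) z = 1 := by
    refine LinearMap.ext fun v => ?_
    change z⁻¹ • z • v = v
    rw [smul_smul, inv_mul_cancel₀ (Complex.exp_ne_zero _), one_smul]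
  have h3 : LinearMap.det (DistribSMul.toLinearMap ℝ (Model n) z) ≠ 0 := by
    intro h0
    have h4 := congrArg LinearMap.det h2
    rw [map_mul, h0, mul_zero, map_one] at h4
    exact zero_ne_one h4
  rw [h1, map_mul]
  exact mul_self_pos.2 h3

section Density

variable {n : ℕ} {X : Type*} [TopologicalSpace X] [ChartedSpace (Model n) X]
  [IsManifold 𝓘(ℂ, Model n) ω X]
  {L : X → Type*} [∀ x, AddCommGroup (L x)] [∀ x, Module ℂ (L x)]
  [TopologicalSpace (TotalSpace ℂ L)] [∀ x, TopologicalSpace (L x)] [FiberBundle ℂ L]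
  [VectorBundle ℂ ℂ L] [ContMDiffVectorBundle ω ℂ L 𝓘(ℂ, Model n)]

/-- The Kähler form at a point of a chart as a bilinear form. -/
noncomputable def kahlerBilin (h : HermitianMetric n L) (φ : OpenPartialHomeomorph X (Model n))
    (y : Model n) : LinearMap.BilinForm ℝ (Model n) :=
  (1 / (2 * Real.pi)) • ddcBilin (fun z => kahlerPotential h (φ.symm y) (φ.symm z)) y

lemma kahlerBilin_apply (h : HermitianMetric n L) (φ : OpenPartialHomeomorph X (Model n))
    (y ξ η : Model n) : kahlerBilin h φ y ξ η = kahlerForm h φ y ξ η := rfl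

lemma liouvilleDensity_eq (h : HermitianMetric n L) (φ : OpenPartialHomeomorph X (Model n))
    (y : Model n) : liouvilleDensity h φ y =
      Real.sqrt (LinearMap.BilinForm.toMatrix (realBasis n) (kahlerBilin h φ y)).det := by
  rw [liouvilleDensity]
  congr 2
  ext i j
  rw [LinearMap.BilinForm.toMatrix_apply, realBasis_apply, realBasis_apply, kahlerBilin_apply]
  rfl

/-- Pulling back by `D` multiplies the determinant of the matrix by `(det D)²`. Its square root
`|det D|` is the Jacobian factor in the change of variables. -/
lemma liouvilleDensity_transition (h : HermitianMetric n L)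
    {φ φ' : OpenPartialHomeomorph X (Model n)} (hφ : φ ∈ atlas (Model n) X)
    (hφ' : φ' ∈ atlas (Model n) X) {y : Model n} (hy : y ∈ φ.target)
    (hy' : φ.symm y ∈ φ'.source) :
    liouvilleDensity h φ y =
      |((fderiv ℂ (fun z => φ' (φ.symm z)) y).restrictScalars ℝ).det| *
        liouvilleDensity h φ' (φ' (φ.symm y)) := by
  set D := (fderiv ℂ (fun z => φ' (φ.symm z)) y).restrictScalars ℝ with hD
  have h1 : kahlerBilin h φ y = (kahlerBilin h φ' (φ' (φ.symm y))).comp D.toLinearMap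
      D.toLinearMap :=
    LinearMap.ext₂ fun ξ η => kahlerForm_transition h hφ hφ' hy hy' ξ η
  rw [liouvilleDensity_eq, liouvilleDensity_eq, h1,
    LinearMap.BilinForm.toMatrix_comp (realBasis n) (realBasis n), Matrix.det_mul, Matrix.det_mul,
    Matrix.det_transpose, LinearMap.det_toMatrix, mul_right_comm,
    Real.sqrt_mul (mul_self_nonneg _), Real.sqrt_mul_self_eq_abs]

lemma continuousOn_liouvilleDensity (h : HermitianMetric n L)
    {φ : OpenPartialHomeomorph X (Model n)} (hφ : φ ∈ atlas (Model n) X) :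
    ContinuousOn (liouvilleDensity h φ) φ.target := by
  refine Real.continuous_sqrt.comp_continuousOn ?_
  refine (Continuous.matrix_det continuous_id).comp_continuousOn
    (continuousOn_pi.2 fun i => continuousOn_pi.2 fun j => ?_)
  exact continuousOn_kahlerForm h hφ _ _

/-- The matrix of `ω(·, I ·)` is symmetric and positive definite. Its determinant is that of `ω`
times that of `I`, and the latter is positive. -/
lemma liouvilleDensity_pos {h : HermitianMetric n L} (hh : IsKahler h)
    {φ : OpenPartialHomeomorph X (Model n)} (hφ : φ ∈ atlas (Model n) X) {y : Model n}
    (hy : y ∈ φ.target) : 0 < liouvilleDensity h φ y := by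
  rw [liouvilleDensity_eq]
  refine Real.sqrt_pos.2 ?_
  set J := DistribSMul.toLinearMap ℝ (Model n) Complex.I with hJ
  set B := kahlerBilin h φ y with hB
  have hsymm : ∀ ξ η, B.comp LinearMap.id J ξ η = B.comp LinearMap.id J η ξ := by
    intro ξ η
    change kahlerForm h φ y ξ (Complex.I • η) = kahlerForm h φ y η (Complex.I • ξ)
    rw [kahlerForm, kahlerForm, ddc_smul_I_symm]
    exact (contDiffAt_kahlerPotential h hφ hy (mem_baseSet_trivializationAt ℂ L _)).of_le
      ENat.LEInfty.out
  have hpd : (LinearMap.BilinForm.toMatrix (realBasis n) (B.comp LinearMap.id J)).PosDef := by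
    refine Matrix.PosDef.of_dotProduct_mulVec_pos ?_ fun x hx => ?_
    · ext i j
      rw [Matrix.conjTranspose_apply, LinearMap.BilinForm.toMatrix_apply,
        LinearMap.BilinForm.toMatrix_apply, hsymm]
      rfl
    · rw [star_trivial, LinearMap.BilinForm.dotProduct_toMatrix_mulVec]
      exact hh φ hφ y hy _ ((LinearEquiv.map_ne_zero_iff (realBasis n).equivFun.symm).2 hx)
  have hdet := hpd.det_pos
  rw [LinearMap.BilinForm.toMatrix_comp (realBasis n) (realBasis n), Matrix.det_mul,
    Matrix.det_mul, Matrix.det_transpose, LinearMap.det_toMatrix, LinearMap.det_toMatrix,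
    LinearMap.det_id, one_mul] at hdet
  exact pos_of_mul_pos_left hdet (det_smul_I_pos n).le

end Density

/-! ### The Liouville volume -/

section Liouville

variable {n : ℕ} {X : Type*} [TopologicalSpace X] [ChartedSpace (Model n) X]
  [IsManifold 𝓘(ℂ, Model n) ω X] [MeasurableSpace X] [BorelSpace X]
  {L : X → Type*} [∀ x, AddCommGroup (L x)] [∀ x, Module ℂ (L x)]
  [TopologicalSpace (TotalSpace ℂ L)] [∀ x, TopologicalSpace (L x)] [FiberBundle ℂ L]
  [VectorBundle ℂ ℂ L] [ContMDiffVectorBundle ω ℂ L 𝓘(ℂ, Model n)]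

lemma measurableSet_target_inter_preimage_symm (φ : OpenPartialHomeomorph X (Model n)) {A : Set X}
    (hA : MeasurableSet A) : MeasurableSet (φ.target ∩ φ.symm ⁻¹' A) := by
  have h1 : Measurable (fun y : φ.target => φ.symm y.1) :=
    (continuousOn_iff_continuous_domRestrict.1 φ.continuousOn_symm).measurable
  have h2 := MeasurableSet.subtype_image φ.open_target.measurableSet (h1 hA)
  have h3 : φ.target ∩ φ.symm ⁻¹' A =
      Subtype.val '' ((fun y : φ.target => φ.symm y.1) ⁻¹' A) := by
    ext y
    constructor
    · rintro ⟨h4, h5⟩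
      exact ⟨⟨y, h4⟩, h5, rfl⟩
    · rintro ⟨⟨z, h4⟩, h5, rfl⟩
      exact ⟨h4, h5⟩
  rwa [h3]

lemma chartLiouville_apply (h : HermitianMetric n L) (φ : OpenPartialHomeomorph X (Model n))
    {A : Set X} (hA : MeasurableSet A) : chartLiouville h φ A =
      ∫⁻ y in φ.target ∩ φ.symm ⁻¹' A, ENNReal.ofReal (liouvilleDensity h φ y) := by
  have h1 : AEMeasurable φ.symm ((volume : Measure (Model n)).restrict φ.target) :=
    φ.continuousOn_symm.aemeasurable φ.open_target.measurableSet
  rw [chartLiouville, Measure.map_apply_of_aemeasurable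
    (h1.mono_ac (withDensity_absolutelyContinuous _ _)) hA, withDensity_apply',
    Measure.restrict_restrict' φ.open_target.measurableSet, inter_comm]

/-- The Liouville volumes of the charts agree on overlaps. -/
lemma chartLiouville_eq_of_subset (h : HermitianMetric n L)
    {φ φ' : OpenPartialHomeomorph X (Model n)} (hφ : φ ∈ atlas (Model n) X)
    (hφ' : φ' ∈ atlas (Model n) X) {A : Set X} (hA : MeasurableSet A)
    (hAs : A ⊆ φ.source ∩ φ'.source) : chartLiouville h φ A = chartLiouville h φ' A := by
  rw [chartLiouville_apply h φ hA, chartLiouville_apply h φ' hA]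
  set S := φ.target ∩ φ.symm ⁻¹' A with hS
  have himage : φ'.target ∩ φ'.symm ⁻¹' A = (fun z => φ' (φ.symm z)) '' S := by
    ext z
    constructor
    · rintro ⟨h1, h2⟩
      have h3 := hAs h2
      refine ⟨φ (φ'.symm z), ⟨φ.map_source h3.1, ?_⟩, ?_⟩
      · rw [mem_preimage, φ.left_inv h3.1]
        exact h2
      · simp only
        rw [φ.left_inv h3.1, φ'.right_inv h1]
    · rintro ⟨y, ⟨-, h2⟩, rfl⟩
      have h3 := hAs h2
      refine ⟨φ'.map_source h3.2, ?_⟩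
      rw [mem_preimage, φ'.left_inv h3.2]
      exact h2
  have hinj : InjOn (fun z => φ' (φ.symm z)) S := by
    intro y hy z hz hyz
    exact φ.symm.injOn hy.1 hz.1 (φ'.injOn (hAs hy.2).2 (hAs hz.2).2 hyz)
  have hder : ∀ y ∈ S, HasFDerivWithinAt (fun z => φ' (φ.symm z))
      ((fderiv ℂ (fun z => φ' (φ.symm z)) y).restrictScalars ℝ) S y := fun y hy =>
    (((contDiffAt_transition hφ hφ' hy.1 (hAs hy.2).2).differentiableAt
      (by simp)).hasFDerivAt.restrictScalars ℝ).hasFDerivWithinAt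
  have hSm := measurableSet_target_inter_preimage_symm φ hA
  rw [himage, lintegral_image_eq_lintegral_abs_det_fderiv_mul volume hSm hder hinj]
  refine setLIntegral_congr_fun hSm fun y hy => ?_
  rw [liouvilleDensity_transition h hφ hφ' hy.1 (hAs hy.2).2, ENNReal.ofReal_mul (abs_nonneg _)]

lemma chartLiouville_inter_source (h : HermitianMetric n L)
    (φ : OpenPartialHomeomorph X (Model n)) {A : Set X} (hA : MeasurableSet A) :
    chartLiouville h φ A = chartLiouville h φ (A ∩ φ.source) := by
  rw [chartLiouville_apply h φ hA,
    chartLiouville_apply h φ (hA.inter φ.open_source.measurableSet)]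
  congr 2
  ext y
  exact ⟨fun hy => ⟨hy.1, hy.2, φ.map_target hy.1⟩, fun hy => ⟨hy.1, hy.2.1⟩⟩

/-- Every point has an open neighbourhood of finite Liouville volume in its preferred chart. -/
lemma exists_isOpen_chartLiouville_lt_top (h : HermitianMetric n L) (x : X) :
    ∃ U, IsOpen U ∧ x ∈ U ∧ U ⊆ (chartAt (Model n) x).source ∧
      chartLiouville h (chartAt (Model n) x) U < ⊤ := by
  set φ := chartAt (Model n) x with hφ
  obtain ⟨r, hr, hball⟩ := Metric.nhds_basis_closedBall.mem_iff.1
    (φ.open_target.mem_nhds (mem_chart_target (Model n) x))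
  have hU := φ.isOpen_inter_preimage (Metric.isOpen_ball (x := φ x) (ε := r))
  refine ⟨_, hU, ⟨mem_chart_source _ _, Metric.mem_ball_self hr⟩, inter_subset_left, ?_⟩
  rw [chartLiouville_apply h φ hU.measurableSet]
  have h1 : IntegrableOn (liouvilleDensity h φ) (Metric.closedBall (φ x) r) :=
    ((continuousOn_liouvilleDensity h (chart_mem_atlas (Model n) x)).mono
      hball).integrableOn_compact (isCompact_closedBall _ _)
  refine lt_of_le_of_lt (lintegral_mono_set ?_) h1.lintegral_lt_top
  rintro y ⟨hy, hy'⟩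
  have h2 := hy'.2
  rw [mem_preimage, φ.right_inv hy] at h2
  exact Metric.ball_subset_closedBall h2

/-- A supremum of measures is bounded by exhibiting a finite measure above all of them. The sum over
a finite cover by sets of finite chart volume serves, since the chart volumes agree on overlaps. -/
lemma liouville_univ_lt_top [CompactSpace X] (h : HermitianMetric n L) : liouville h univ < ⊤ := by
  choose U hU hxU hUs hUfin using exists_isOpen_chartLiouville_lt_top (n := n) (L := L) h
  obtain ⟨t, ht⟩ := isCompact_univ.elim_nhds_subcover U fun x _ => (hU x).mem_nhds (hxU x)
  set ν : Measure X := ∑ x ∈ t, (chartLiouville h (chartAt (Model n) x)).restrict (U x) with hν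
  have hle : liouville h ≤ ν := by
    refine iSup₂_le fun φ hφ => Measure.le_iff.2 fun A hA => ?_
    have hAm := hA.inter φ.open_source.measurableSet
    calc chartLiouville h φ A = chartLiouville h φ (A ∩ φ.source) :=
          chartLiouville_inter_source h φ hA
      _ ≤ chartLiouville h φ (⋃ x ∈ t, A ∩ φ.source ∩ U x) := by
          refine measure_mono fun y hy => ?_
          obtain ⟨x, hx, hyx⟩ := mem_iUnion₂.1 (ht.2 (mem_univ y))
          exact mem_iUnion₂.2 ⟨x, hx, hy, hyx⟩
      _ ≤ ∑ x ∈ t, chartLiouville h φ (A ∩ φ.source ∩ U x) := measure_biUnion_finset_le _ _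
      _ = ∑ x ∈ t, chartLiouville h (chartAt (Model n) x) (A ∩ φ.source ∩ U x) := by
          refine Finset.sum_congr rfl fun x _ => ?_
          exact chartLiouville_eq_of_subset h hφ (chart_mem_atlas (Model n) x)
            (hAm.inter (hU x).measurableSet) fun y hy => ⟨hy.1.2, hUs x hy.2⟩
      _ ≤ ∑ x ∈ t, chartLiouville h (chartAt (Model n) x) (A ∩ U x) :=
          Finset.sum_le_sum fun x _ => measure_mono fun y hy => ⟨hy.1.1, hy.2⟩
      _ = ν A := by
          rw [hν, Measure.finsetSum_apply]
          exact Finset.sum_congr rfl fun x _ => (Measure.restrict_apply hA).symm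
  refine lt_of_le_of_lt (hle univ) ?_
  rw [hν, Measure.finsetSum_apply]
  refine ENNReal.sum_lt_top.2 fun x _ => ?_
  rw [Measure.restrict_apply_univ]
  exact hUfin x

lemma isFiniteMeasure_liouville [CompactSpace X] (h : HermitianMetric n L) :
    IsFiniteMeasure (liouville h) := ⟨liouville_univ_lt_top h⟩

/-- The Liouville volume of a Kähler form charges nonempty open sets. -/
lemma liouville_pos_of_isOpen {h : HermitianMetric n L} (hh : IsKahler h) {A : Set X}
    (hA : IsOpen A) {x : X} (hx : x ∈ A) : 0 < liouville h A := by
  set φ := chartAt (Model n) x with hφ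
  have hφa : φ ∈ atlas (Model n) X := chart_mem_atlas (Model n) x
  have hle : chartLiouville h φ A ≤ liouville h A :=
    (le_iSup₂ (f := fun φ (_ : φ ∈ atlas (Model n) X) => chartLiouville h φ) φ hφa) A
  refine lt_of_lt_of_le ?_ hle
  rw [chartLiouville_apply h φ hA.measurableSet, pos_iff_ne_zero]
  have hS : IsOpen (φ.target ∩ φ.symm ⁻¹' A) := φ.isOpen_inter_preimage_symm hA
  have hxS : φ x ∈ φ.target ∩ φ.symm ⁻¹' A := by
    refine ⟨mem_chart_target _ x, ?_⟩
    rw [mem_preimage, φ.left_inv (mem_chart_source _ x)]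
    exact hx
  intro h0
  have hmeas : AEMeasurable (fun y => ENNReal.ofReal (liouvilleDensity h φ y))
      ((volume : Measure (Model n)).restrict (φ.target ∩ φ.symm ⁻¹' A)) :=
    (((continuousOn_liouvilleDensity h hφa).mono inter_subset_left).aemeasurable
      hS.measurableSet).ennreal_ofReal
  rw [lintegral_eq_zero_iff' hmeas, Filter.EventuallyEq, ae_restrict_iff' hS.measurableSet] at h0
  have h1 : (volume : Measure (Model n)) (φ.target ∩ φ.symm ⁻¹' A) = 0 := by
    refine measure_mono_null (fun y hy => ?_) h0
    rw [mem_compl_iff, mem_ofPred_eq]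
    intro h2
    have h3 := h2 hy
    rw [Pi.zero_apply, ENNReal.ofReal_eq_zero] at h3
    exact absurd (liouvilleDensity_pos hh hφa hy.1) (not_lt.2 h3)
  exact (hS.measure_pos volume ⟨_, hxS⟩).ne' h1

end Liouville

/-! ### Derivatives of deformations -/

section DirDeriv

variable {n : ℕ} {X : Type*} [TopologicalSpace X] [ChartedSpace (Model n) X]
variable {L : X → Type*} [∀ x, AddCommGroup (L x)] [∀ x, Module ℂ (L x)]
  [TopologicalSpace (TotalSpace ℂ L)] [∀ x, TopologicalSpace (L x)] [FiberBundle ℂ L]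
  [VectorBundle ℂ ℂ L] {δ : ℙ ℂ (H0 n L) → SmoothFun n X}

lemma dirDeriv_add {N : ℕ} (β : Module.Basis (Fin N) ℂ (H0 n L))
    (hδ : IsSmoothDeformation δ) {s : H0 n L} (hs : s ≠ 0) (v w : H0 n L) (x : X) :
    dirDeriv δ s (v + w) x = dirDeriv δ s v x + dirDeriv δ s w x := by
  have hc : β.equivFun s ≠ 0 := (LinearEquiv.map_ne_zero_iff _).2 hs
  have key := fun v' => dirDeriv_eq_fderiv β hδ hc (β.equivFun v') x
  simp only [LinearEquiv.symm_apply_apply] at key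
  rw [key, key, key, map_add, map_add]

lemma hasDerivAt_onSections {N : ℕ} (β : Module.Basis (Fin N) ℂ (H0 n L))
    (hδ : IsSmoothDeformation δ)
    {s : H0 n L} (hs : s ≠ 0) (v : H0 n L) (x : X) :
    HasDerivAt (fun t : ℝ => onSections δ (s + (t : ℂ) • v) x) (dirDeriv δ s v x) 0 := by
  have hc : β.equivFun s ≠ 0 := (LinearEquiv.map_ne_zero_iff _).2 hs
  have h2 : HasDerivAt (fun t : ℝ => β.equivFun s + t • β.equivFun v) (β.equivFun v) 0 := by
    simpa using ((hasDerivAt_id (0 : ℝ)).smul_const (β.equivFun v)).const_add (β.equivFun s)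
  have h1 : DifferentiableAt ℝ (fun c => onSections δ (β.equivFun.symm c) x)
      (β.equivFun s + (0 : ℝ) • β.equivFun v) := by
    rw [zero_smul, add_zero]
    exact differentiableAt_onSections β hδ hc x
  have h3 := (h1.hasFDerivAt.comp_hasDerivAt (0 : ℝ) h2).differentiableAt
  have h4 : ((fun c => onSections δ (β.equivFun.symm c) x) ∘
      fun t : ℝ => β.equivFun s + t • β.equivFun v) =
      fun t : ℝ => onSections δ (s + (t : ℂ) • v) x := by
    ext t
    rw [Function.comp_apply, ← Complex.coe_smul, ← map_smul, ← map_add,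
      LinearEquiv.symm_apply_apply]
  rw [h4] at h3
  exact h3.hasDerivAt

/-- Moving along a multiple of `s` does not move `[s]` for small times. Hence only the part of a
direction orthogonal to `s` matters. -/
lemma dirDeriv_smul_self (s : H0 n L) (z : ℂ) (x : X) : dirDeriv δ s (z • s) x = 0 := by
  have h1 : (fun t : ℝ => onSections δ (s + (t : ℂ) • z • s) x) =ᶠ[𝓝 0]
      fun _ => onSections δ s x := by
    have h2 : Continuous (fun t : ℝ => 1 + (t : ℂ) * z) := by fun_prop
    have h3 : ∀ᶠ t : ℝ in 𝓝 0, 1 + (t : ℂ) * z ≠ 0 :=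
      h2.continuousAt.eventually_ne (by simp)
    filter_upwards [h3] with t ht
    rw [← onSections_smul s ht, add_smul, one_smul, mul_smul]
  rw [dirDeriv, h1.deriv_eq, deriv_const]

/-- Invariance of `δ` under scaling reduces arbitrary sections and directions to the unit vectors in
`IsSmall`. -/
lemma dirDeriv_smul_smul (s v : H0 n L) {a : ℝ} (ha : a ≠ 0) (b : ℝ) (x : X) :
    dirDeriv δ ((a : ℂ) • s) ((b : ℂ) • v) x = b / a * dirDeriv δ s v x := by
  have h1 : (fun t : ℝ => onSections δ ((a : ℂ) • s + (t : ℂ) • (b : ℂ) • v) x) =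
      fun t : ℝ => (fun t : ℝ => onSections δ (s + (t : ℂ) • v) x) (b / a * t) := by
    ext t
    simp only
    rw [← onSections_smul (s + ((b / a * t : ℝ) : ℂ) • v) (Complex.ofReal_ne_zero.2 ha), smul_add,
      smul_smul, smul_smul, ← Complex.ofReal_mul, ← Complex.ofReal_mul,
      show a * (b / a * t) = t * b by field_simp]
  rw [dirDeriv, h1, deriv_comp_mul_left (b / a) (fun t : ℝ => onSections δ (s + (t : ℂ) • v) x),
    mul_zero, smul_eq_mul]
  rfl

lemma continuous_onSections (s : H0 n L) : Continuous (onSections δ s) := by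
  by_cases hs : s = 0
  · have : onSections δ s = fun _ => 0 := by
      ext x
      exact dif_neg (not_not.2 hs)
    rw [this]
    exact continuous_const
  · have : onSections δ s = δ (Projectivization.mk ℂ s hs) := by
      ext x
      exact onSections_of_ne_zero hs x
    rw [this]
    exact (δ (Projectivization.mk ℂ s hs)).contMDiff.continuous

/-- As a function of the point, the derivative is a pointwise limit of difference quotients along a
sequence, and these are continuous. -/
lemma measurable_dirDeriv [MeasurableSpace X] [BorelSpace X] {N : ℕ}
    (β : Module.Basis (Fin N) ℂ (H0 n L)) (hδ : IsSmoothDeformation δ) {s : H0 n L}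
    (hs : s ≠ 0) (v : H0 n L) : Measurable (dirDeriv δ s v) := by
  set τ : ℕ → ℝ := fun m => 1 / ((m : ℝ) + 1) with hτ
  have hτ0 : Filter.Tendsto τ Filter.atTop (𝓝[≠] 0) :=
    tendsto_nhdsWithin_iff.2 ⟨tendsto_one_div_add_atTop_nhds_zero_nat,
      Filter.Eventually.of_forall fun m => (Nat.one_div_pos_of_nat (α := ℝ)).ne'⟩
  refine measurable_of_tendsto_metrizable (f := fun m x =>
    slope (fun t : ℝ => onSections δ (s + (t : ℂ) • v) x) 0 (τ m)) (fun m => ?_) ?_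
  · simp only [slope_def_field]
    exact ((continuous_onSections _).sub (continuous_onSections _)).div_const _ |>.measurable
  · refine tendsto_pi_nhds.2 fun x => ?_
    exact (hasDerivAt_onSections β hδ hs v x).tendsto_slope.comp hτ0

end DirDeriv

/-! ### The scalar product of sections -/

section Inner

variable {n : ℕ} {X : Type*} [TopologicalSpace X] [ChartedSpace (Model n) X]
  [MeasurableSpace X]
variable {L : X → Type*} [∀ x, AddCommGroup (L x)] [∀ x, Module ℂ (L x)]
  [TopologicalSpace (TotalSpace ℂ L)] [∀ x, TopologicalSpace (L x)] [FiberBundle ℂ L]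
  [VectorBundle ℂ ℂ L] {δ : ℙ ℂ (H0 n L) → SmoothFun n X}

lemma inner_smul_smul (h : HermitianMetric n L) (x : X) (a b : ℂ) (v w : L x) :
    h.inner x (a • v) (b • w) = (starRingEnd ℂ) a * b * h.inner x v w := by
  rw [LinearMap.map_smulₛₗ (h.inner x), LinearMap.smul_apply, map_smul, smul_eq_mul, smul_eq_mul,
    mul_assoc]

lemma l2Inner_smul_smul (h : HermitianMetric n L) (a b : ℂ) (s t : ∀ x, L x) :
    l2Inner h (a • s) (b • t) = (starRingEnd ℂ) a * b * l2Inner h s t := by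
  rw [l2Inner, l2Inner, ← integral_const_mul]
  congr 1
  ext x
  exact inner_smul_smul h x a b _ _

/-- The squared norm of a section. -/
noncomputable def normSq (h : HermitianMetric n L) (s : Γ n L) : ℝ :=
  ∫ x, (h.inner x (s.1 x) (s.1 x)).re ∂(liouville h)

lemma l2Inner_self (h : HermitianMetric n L) (s : Γ n L) :
    l2Inner h s.1 s.1 = (normSq h s : ℂ) := by
  rw [l2Inner, normSq, ← integral_complex_ofReal]
  congr 1
  ext x
  exact inner_self_eq_re h x _

/-- The oscillation of the derivatives of an `ε`-small deformation. -/
lemma IsSmall.dirDeriv_sub_le {h : HermitianMetric n L} {ε : ℝ} (hε : IsSmall h ε δ)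
    {s v : H0 n L} (hs : 0 < normSq h s.1) (hv : 0 < normSq h v.1)
    (hsv : l2Inner h s.1.1 v.1.1 = 0) (x y : X) :
    dirDeriv δ s v x - dirDeriv δ s v y ≤
      ε * (Real.sqrt (normSq h v.1) / Real.sqrt (normSq h s.1)) := by
  set a := Real.sqrt (normSq h s.1) with ha
  set b := Real.sqrt (normSq h v.1) with hb
  have ha0 : 0 < a := Real.sqrt_pos.2 hs
  have hb0 : 0 < b := Real.sqrt_pos.2 hv
  have hnorm : ∀ (t : H0 n L) (c : ℝ), 0 < c → c ^ 2 = normSq h t.1 →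
      l2Inner h (((c⁻¹ : ℝ) : ℂ) • t).1.1 (((c⁻¹ : ℝ) : ℂ) • t).1.1 = 1 := by
    intro t c hc hct
    have h1 := l2Inner_smul_smul h ((c⁻¹ : ℝ) : ℂ) ((c⁻¹ : ℝ) : ℂ) t.1.1 t.1.1
    refine h1.trans ?_
    rw [l2Inner_self, Complex.conj_ofReal, ← hct, ← Complex.ofReal_mul, ← Complex.ofReal_mul,
      ← Complex.ofReal_one]
    congr 1
    field_simp
  have h1 := hε.2 (((a⁻¹ : ℝ) : ℂ) • s) (((b⁻¹ : ℝ) : ℂ) • v)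
    (hnorm s a ha0 (Real.sq_sqrt hs.le)) (hnorm v b hb0 (Real.sq_sqrt hv.le))
    ((l2Inner_smul_smul h _ _ s.1.1 v.1.1).trans (by rw [hsv, mul_zero])) x y
  have h2 := fun x => dirDeriv_smul_smul (δ := δ) s v (inv_ne_zero ha0.ne') b⁻¹ x
  simp only [dirDeriv] at h2
  rw [h2, h2, ← mul_sub, show b⁻¹ / a⁻¹ = a / b by field_simp] at h1
  rw [← div_le_iff₀ (by positivity)]
  refine le_trans (le_of_eq ?_) h1
  simp only [dirDeriv]
  field_simp

variable [BorelSpace X] [CompactSpace X] [IsManifold 𝓘(ℂ, Model n) ω X]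
  [ContMDiffVectorBundle ω ℂ L 𝓘(ℂ, Model n)]

lemma integrable_inner (h : HermitianMetric n L) (s t : Γ n L) :
    Integrable (fun x => h.inner x (s.1 x) (t.1 x)) (liouville h) := by
  have := isFiniteMeasure_liouville h
  have hc := continuous_inner h s t
  obtain ⟨C, hC⟩ := isCompact_univ.exists_bound_of_continuousOn hc.continuousOn
  exact Integrable.of_bound hc.aestronglyMeasurable C
    (Filter.Eventually.of_forall fun x => hC x (mem_univ x))

/-- The pointwise squared length is continuous and nonnegative, and its support is open and
nonempty, hence of positive volume. -/
lemma normSq_pos {h : HermitianMetric n L} (hh : IsKahler h) {s : Γ n L} (hs : s ≠ 0) :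
    0 < normSq h s := by
  obtain ⟨x, hx⟩ : ∃ x, s.1 x ≠ 0 := by
    by_contra! h0
    exact hs (by ext x; exact h0 x)
  have hc : Continuous fun x => (h.inner x (s.1 x) (s.1 x)).re :=
    Complex.continuous_re.comp (continuous_inner h s s)
  rw [normSq, integral_pos_iff_support_of_nonneg (fun x => inner_self_re_nonneg h x _)
    (integrable_inner h s s).re]
  exact liouville_pos_of_isOpen hh hc.isOpen_support (h.pos x _ hx).ne'

end Inner

/-! ### Positivity of the Fubini–Study form -/

section FubiniStudy

variable {n : ℕ} {X : Type*} [TopologicalSpace X] [ChartedSpace (Model n) X]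
  [MeasurableSpace X]
variable {L : X → Type*} [∀ x, AddCommGroup (L x)] [∀ x, Module ℂ (L x)]
  [TopologicalSpace (TotalSpace ℂ L)] [∀ x, TopologicalSpace (L x)] [FiberBundle ℂ L]
  [VectorBundle ℂ ℂ L]

/-- Weighted arithmetic-geometric mean inequality. With `r = |u| / |s|` both terms have the same
integral, so the integrated bound is as good as Cauchy–Schwarz in `L²`. -/
lemma norm_inner_le (h : HermitianMetric n L) (x : X) (v w : L x) {r : ℝ} (hr : 0 < r) :
    ‖h.inner x v w‖ ≤ ((h.inner x v v).re / r + r * (h.inner x w w).re) / 2 := by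
  have hx := mem_baseSet_trivializationAt ℂ L x
  have hH := frameSq_pos h hx
  rw [inner_eq h hx, inner_self_re_eq h hx, inner_self_re_eq h hx, norm_mul, norm_mul,
    RCLike.norm_conj, Complex.norm_real, Real.norm_of_nonneg hH.le]
  have h1 : (‖coord L x x v‖ ^ 2 * frameSq h x x / r + r * (‖coord L x x w‖ ^ 2 * frameSq h x x))
      / 2 - ‖coord L x x v‖ * ‖coord L x x w‖ * frameSq h x x =
      frameSq h x x / (2 * r) * (‖coord L x x v‖ - r * ‖coord L x x w‖) ^ 2 := by
    field_simp
    ring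
  have h2 : 0 ≤ frameSq h x x / (2 * r) * (‖coord L x x v‖ - r * ‖coord L x x w‖) ^ 2 := by
    positivity
  linarith

lemma inner_phase (h : HermitianMetric n L) (x : X) {e : ℂ} (he : ‖e‖ = 1) (v w : L x) :
    h.inner x (e • v) (e • w) = h.inner x v w := by
  rw [inner_smul_smul, Complex.conj_mul', he]
  simp

variable [BorelSpace X] [CompactSpace X] [IsManifold 𝓘(ℂ, Model n) ω X]
  [ContMDiffVectorBundle ω ℂ L 𝓘(ℂ, Model n)]

/-- Let `u ⊥ s`, and let `P, Q` be functions that are small compared with `|u| / |s|`. Up to a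
common phase, and modulo multiples of `s`, the Fubini–Study form at `s` is positive on the pair
`u + i P s`, `i u + i Q s`. -/
lemma fubiniStudy_pos (h : HermitianMetric n L) {s u : Γ n L} (hs : 0 < normSq h s)
    (hu : 0 < normSq h u) (hus : l2Inner h u.1 s.1 = 0) {P Q : X → ℝ} (hP : Measurable P)
    (hQ : Measurable Q)
    (hPb : ∀ x, |P x| ≤ 1 / 4 * (Real.sqrt (normSq h u) / Real.sqrt (normSq h s)))
    (hQb : ∀ x, |Q x| ≤ 1 / 4 * (Real.sqrt (normSq h u) / Real.sqrt (normSq h s)))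
    {a a' : ℂ} {e : X → ℂ} (he : ∀ x, ‖e x‖ = 1) {σ v w : ∀ x, L x}
    (hσ : ∀ x, σ x = e x • s.1 x)
    (hv : ∀ x, v x = e x • (u.1 x + (Complex.I * P x + a) • s.1 x))
    (hw : ∀ x, w x = e x • (Complex.I • u.1 x + (Complex.I * Q x + a') • s.1 x)) :
    0 < fubiniStudy h σ v w := by
  set μ := liouville h with hμ
  set S := normSq h s with hS
  set U := normSq h u with hU
  set r := Real.sqrt U / Real.sqrt S with hr
  have hr0 : 0 < r := div_pos (Real.sqrt_pos.2 hu) (Real.sqrt_pos.2 hs)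
  have hrS : r * r * S = U := by
    rw [hr, div_mul_div_comm, Real.mul_self_sqrt hu.le, Real.mul_self_sqrt hs.le,
      div_mul_cancel₀ _ hs.ne']
  set ns : X → ℝ := fun x => (h.inner x (s.1 x) (s.1 x)).re with hns
  set nu : X → ℝ := fun x => (h.inner x (u.1 x) (u.1 x)).re with hnu
  set k : X → ℂ := fun x => h.inner x (u.1 x) (s.1 x) with hk
  have ins : Integrable ns μ := (integrable_inner h s s).re
  have inu : Integrable nu μ := (integrable_inner h u u).re
  have ik : Integrable k μ := integrable_inner h u s
  have hPm := hP.aestronglyMeasurable (μ := μ)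
  have hQm := hQ.aestronglyMeasurable (μ := μ)
  have hPcm : AEStronglyMeasurable (fun x => (P x : ℂ)) μ :=
    (Complex.measurable_ofReal.comp hP).aestronglyMeasurable
  have hPcb : ∀ x, ‖(P x : ℂ)‖ ≤ 1 / 4 * r := fun x => by
    rw [Complex.norm_real]
    exact hPb x
  have hQcm : AEStronglyMeasurable (fun x => (Q x : ℂ)) μ :=
    (Complex.measurable_ofReal.comp hQ).aestronglyMeasurable
  have hQcb : ∀ x, ‖(Q x : ℂ)‖ ≤ 1 / 4 * r := fun x => by
    rw [Complex.norm_real]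
    exact hQb x
  have iPns : Integrable (fun x => P x * ns x) μ :=
    ins.bdd_mul hPm (Filter.Eventually.of_forall hPb)
  have iQns : Integrable (fun x => Q x * ns x) μ :=
    ins.bdd_mul hQm (Filter.Eventually.of_forall hQb)
  have iPQns : Integrable (fun x => P x * (Q x * ns x)) μ :=
    iQns.bdd_mul hPm (Filter.Eventually.of_forall hPb)
  have iQk : Integrable (fun x => (Q x : ℂ) * k x) μ :=
    ik.bdd_mul hQcm (Filter.Eventually.of_forall hQcb)
  have ikc : Integrable (fun x => (starRingEnd ℂ) (k x)) μ :=
    (Complex.conjLIE.toContinuousLinearEquiv.toContinuousLinearMap).integrable_comp ik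
  have iPk : Integrable (fun x => (P x : ℂ) * (starRingEnd ℂ) (k x)) μ :=
    ikc.bdd_mul hPcm (Filter.Eventually.of_forall hPcb)
  -- Bundling integrability with the value of the integral lets the products below be integrated
  -- term by term.
  let HI : (X → ℂ) → ℂ → Prop := fun f z => Integrable f μ ∧ ∫ x, f x ∂μ = z
  have hadd : ∀ {f g z z'}, HI f z → HI g z' → HI (fun x => f x + g x) (z + z') :=
    fun hf hg => ⟨hf.1.add hg.1, by rw [integral_add hf.1 hg.1, hf.2, hg.2]⟩
  have hmul : ∀ {f z} (c : ℂ), HI f z → HI (fun x => c * f x) (c * z) :=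
    fun c hf => ⟨hf.1.const_mul c, by rw [integral_const_mul, hf.2]⟩
  have hreal : ∀ {f : X → ℝ}, Integrable f μ → HI (fun x => (f x : ℂ)) ((∫ x, f x ∂μ : ℝ) : ℂ) :=
    fun hf => ⟨hf.ofReal, integral_complex_ofReal⟩
  set A := ∫ x, P x * ns x ∂μ
  set B := ∫ x, Q x * ns x ∂μ
  set R := ∫ x, P x * (Q x * ns x) ∂μ
  set C := ∫ x, (Q x : ℂ) * k x ∂μ with hC
  set D := ∫ x, (P x : ℂ) * (starRingEnd ℂ) (k x) ∂μ with hD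
  have Hns : HI (fun x => (ns x : ℂ)) S := hreal ins
  have Hnu : HI (fun x => (nu x : ℂ)) U := hreal inu
  have HA := hreal iPns
  have HB := hreal iQns
  have HR := hreal iPQns
  have HC : HI (fun x => (Q x : ℂ) * k x) C := ⟨iQk, rfl⟩
  have HD : HI (fun x => (P x : ℂ) * (starRingEnd ℂ) (k x)) D := ⟨iPk, rfl⟩
  have Hk : HI k 0 := ⟨ik, hus⟩
  have Hkc : HI (fun x => (starRingEnd ℂ) (k x)) 0 :=
    ⟨ikc, by rw [integral_conj, Hk.2, map_zero]⟩
  have euu : ∀ x, h.inner x (u.1 x) (u.1 x) = (nu x : ℂ) := fun x => inner_self_eq_re h x _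
  have ess : ∀ x, h.inner x (s.1 x) (s.1 x) = (ns x : ℂ) := fun x => inner_self_eq_re h x _
  have eus : ∀ x, h.inner x (u.1 x) (s.1 x) = k x := fun x => rfl
  have esu : ∀ x, h.inner x (s.1 x) (u.1 x) = (starRingEnd ℂ) (k x) := fun x =>
    (h.conj_symm x _ _).symm
  have hSS : l2Inner h σ σ = S := by
    rw [← Hns.2, l2Inner]
    congr 1
    ext x
    rw [hσ, inner_phase h x (he x), ess]
  have hvs : l2Inner h v σ = -Complex.I * A + (starRingEnd ℂ) a * S := by
    have H := hadd Hk (hadd (hmul (-Complex.I) HA) (hmul ((starRingEnd ℂ) a) Hns))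
    rw [zero_add] at H
    rw [← H.2, l2Inner]
    congr 1
    ext x
    rw [hσ, hv, inner_phase h x (he x)]
    simp only [map_add, LinearMap.map_smulₛₗ (h.inner x), LinearMap.add_apply,
      LinearMap.smul_apply, smul_eq_mul, map_mul, Complex.conj_I, Complex.conj_ofReal, eus, ess,
      Complex.ofReal_mul]
    ring
  have hsw : l2Inner h σ w = Complex.I * B + a' * S := by
    have H := hadd (hmul Complex.I Hkc) (hadd (hmul Complex.I HB) (hmul a' Hns))
    rw [mul_zero, zero_add] at H
    rw [← H.2, l2Inner]
    congr 1
    ext x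
    rw [hσ, hw, inner_phase h x (he x)]
    simp only [map_add, map_smul, smul_eq_mul, esu, ess, Complex.ofReal_mul]
    ring
  have hvw : l2Inner h v w = Complex.I * U + Complex.I * C + D + R + a' * (-Complex.I * A) +
      (starRingEnd ℂ) a * (Complex.I * B) + (starRingEnd ℂ) a * a' * S := by
    have H := hadd (hadd (hadd (hadd (hadd (hadd (hadd (hadd (hmul Complex.I Hnu)
      (hmul Complex.I HC)) HD) HR) (hmul a' (hmul (-Complex.I) HA)))
      (hmul ((starRingEnd ℂ) a) (hmul Complex.I HB))) (hmul ((starRingEnd ℂ) a * a') Hns))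
      (hmul a' Hk)) (hmul ((starRingEnd ℂ) a * Complex.I) Hkc)
    rw [mul_zero, mul_zero, add_zero, add_zero] at H
    rw [← H.2, l2Inner]
    congr 1
    ext x
    rw [hv, hw, inner_phase h x (he x)]
    simp only [map_add, LinearMap.map_smulₛₗ (h.inner x), LinearMap.add_apply,
      LinearMap.smul_apply, map_smul, smul_eq_mul, map_mul, Complex.conj_I, Complex.conj_ofReal,
      euu, eus, esu, ess, Complex.ofReal_mul]
    linear_combination (-(P x : ℂ) * (starRingEnd ℂ) (k x) - P x * Q x * ns x) * Complex.I_mul_I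
  have hbound : ∀ (f : X → ℝ), (∀ x, |f x| ≤ 1 / 4 * r) → ∀ x, |f x| * ‖k x‖ ≤
      1 / 4 * r * ((nu x / r + r * ns x) / 2) := fun f hf x =>
    mul_le_mul (hf x) (norm_inner_le h x _ _ hr0) (norm_nonneg _) (by positivity)
  have ibound : Integrable (fun x => 1 / 4 * r * ((nu x / r + r * ns x) / 2)) μ :=
    (((inu.div_const r).add (ins.const_mul r)).div_const 2).const_mul _
  -- By `r² |s|² = |u|²` both halves of the bound contribute `|u|² / 8`.
  have hval : ∫ x, 1 / 4 * r * ((nu x / r + r * ns x) / 2) ∂μ = U / 4 := by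
    rw [integral_const_mul, integral_div, integral_add (inu.div_const r) (ins.const_mul r),
      integral_div, integral_const_mul]
    change 1 / 4 * r * ((U / r + r * S) / 2) = U / 4
    rw [← hrS]
    field_simp
    ring
  have hCb : ‖C‖ ≤ U / 4 := by
    rw [← hval]
    refine norm_integral_le_of_norm_le ibound (Filter.Eventually.of_forall fun x => ?_)
    rw [norm_mul, Complex.norm_real]
    exact hbound Q hQb x
  have hDb : ‖D‖ ≤ U / 4 := by
    rw [← hval]
    refine norm_integral_le_of_norm_le ibound (Filter.Eventually.of_forall fun x => ?_)
    rw [norm_mul, Complex.norm_real, RCLike.norm_conj]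
    exact hbound P hPb x
  have hSc : (S : ℂ) ≠ 0 := Complex.ofReal_ne_zero.2 hs.ne'
  -- All terms with `a` or `a'` cancel, as the form ignores multiples of the section. The terms `R`
  -- and `A B`, quadratic in `P` and `Q`, are real.
  have hfs : l2Inner h v w / l2Inner h σ σ - l2Inner h v σ * l2Inner h σ w / (l2Inner h σ σ) ^ 2 =
      (Complex.I * U + Complex.I * C + D) / S + ((R / S - A * B / S ^ 2 : ℝ) : ℂ) := by
    rw [hSS, hvs, hsw, hvw]
    push_cast
    field_simp
    linear_combination ((A : ℂ) * B) * Complex.I_sq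
  have him : (l2Inner h v w / l2Inner h σ σ -
      l2Inner h v σ * l2Inner h σ w / (l2Inner h σ σ) ^ 2).im = (U + C.re + D.im) / S := by
    rw [hfs, Complex.add_im, Complex.ofReal_im, Complex.div_ofReal_im]
    simp
  rw [fubiniStudy, him]
  have h1 := (abs_le.1 ((Complex.abs_re_le_norm C).trans hCb)).1
  have h2 := (abs_le.1 ((Complex.abs_im_le_norm D).trans hDb)).1
  have h3 : 0 < U + C.re + D.im := by linarith
  have := Real.pi_pos
  positivity

end FubiniStudy

/-! ### The deformed linear system is symplectic -/

section Symplectic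

variable {n : ℕ} {X : Type*} [TopologicalSpace X] [ChartedSpace (Model n) X]
  [MeasurableSpace X] [BorelSpace X] [CompactSpace X] [IsManifold 𝓘(ℂ, Model n) ω X]
variable {L : X → Type*} [∀ x, AddCommGroup (L x)] [∀ x, Module ℂ (L x)]
  [TopologicalSpace (TotalSpace ℂ L)] [∀ x, TopologicalSpace (L x)] [FiberBundle ℂ L]
  [VectorBundle ℂ ℂ L] [ContMDiffVectorBundle ω ℂ L 𝓘(ℂ, Model n)]
  {δ : ℙ ℂ (H0 n L) → SmoothFun n X}

lemma conj_l2Inner (h : HermitianMetric n L) (s t : ∀ x, L x) :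
    (starRingEnd ℂ) (l2Inner h s t) = l2Inner h t s := by
  rw [l2Inner, l2Inner, ← integral_conj]
  congr 1
  ext x
  exact h.conj_symm x _ _

lemma l2Inner_sub_smul (h : HermitianMetric n L) (s w t : Γ n L) (c : ℂ) :
    l2Inner h s.1 (w - c • t).1 = l2Inner h s.1 w.1 - c * l2Inner h s.1 t.1 := by
  rw [l2Inner, l2Inner, l2Inner, ← integral_const_mul,
    ← integral_sub (integrable_inner h s w) ((integrable_inner h s t).const_mul c)]
  congr 1
  ext x
  change h.inner x (s.1 x) (w.1 x - c • t.1 x) = _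
  rw [map_sub, map_smul, smul_eq_mul]

/-- The complex structure of the undeformed linear system is tamed by the form on the deformed one.
This is stronger than nondegeneracy. -/
lemma fubiniStudy_famDeriv_pos {h : HermitianMetric n L} (hh : IsKahler h)
    (hδ : IsSmoothDeformation δ) (hsmall : IsSmall h (1 / 4) δ) [Nonempty X]
    {N : ℕ} (β : Module.Basis (Fin N) ℂ (H0 n L)) {k : ℕ} {c₀ : Fin N → ℂ}
    {A : EuclideanSpace ℝ (Fin k) →L[ℝ] (Fin N → ℂ)} {b ξ η : EuclideanSpace ℝ (Fin k)}
    (hb : c₀ + A b ≠ 0) (hη : A η = Complex.I • A ξ)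
    (hξ : ∀ z : ℂ, A ξ ≠ z • (c₀ + A b)) :
    0 < fubiniStudy h (deformedSection δ (β.equivFun.symm (c₀ + A b))).1
      (famDeriv (fun b => deformedSection δ (β.equivFun.symm (c₀ + A b))) b ξ)
      (famDeriv (fun b => deformedSection δ (β.equivFun.symm (c₀ + A b))) b η) := by
  set s : H0 n L := β.equivFun.symm (c₀ + A b) with hs
  set w : H0 n L := β.equivFun.symm (A ξ) with hw
  have hs0 : s ≠ 0 := (LinearEquiv.map_ne_zero_iff _).2 hb
  have hsΓ : s.1 ≠ 0 := fun h0 => hs0 (Subtype.ext h0)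
  have hS : 0 < normSq h s.1 := normSq_pos hh hsΓ
  -- The coefficient that makes `u = w - z s` orthogonal to `s`.
  set z : ℂ := l2Inner h s.1.1 w.1.1 / normSq h s.1 with hz
  set u : H0 n L := w - z • s with hu
  have hwu : w = u + z • s := (sub_add_cancel w (z • s)).symm
  have hIw : Complex.I • w = Complex.I • u + (Complex.I * z) • s := by
    rw [hwu, smul_add, smul_smul]
  have hu0 : u ≠ 0 := by
    intro h0
    rw [h0, zero_add, hw, hs, ← map_smul] at hwu
    exact hξ z (β.equivFun.symm.injective hwu)
  have hU : 0 < normSq h u.1 := normSq_pos hh fun h0 => hu0 (Subtype.ext h0)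
  have hsu : l2Inner h s.1.1 u.1.1 = 0 := by
    have h1 := l2Inner_sub_smul h s.1 w.1 s.1 z
    rw [l2Inner_self, hz, div_mul_cancel₀ _ (Complex.ofReal_ne_zero.2 hS.ne'), sub_self] at h1
    exact h1
  have hus : l2Inner h u.1.1 s.1.1 = 0 := by
    rw [← conj_l2Inner, hsu, map_zero]
  have hsIu : l2Inner h s.1.1 (Complex.I • u).1.1 = 0 := by
    have h1 := l2Inner_smul_smul h 1 Complex.I s.1.1 u.1.1
    rw [hsu, mul_zero, one_smul] at h1
    exact h1
  have hIU : normSq h (Complex.I • u).1 = normSq h u.1 := by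
    have h1 := l2Inner_smul_smul h Complex.I Complex.I u.1.1 u.1.1
    rw [Complex.conj_I, neg_mul, Complex.I_mul_I, neg_neg, one_mul, l2Inner_self] at h1
    exact Complex.ofReal_injective ((l2Inner_self h (Complex.I • u).1).symm.trans h1)
  obtain ⟨x₀⟩ := ‹Nonempty X›
  have hp : ∀ x, dirDeriv δ s w x = dirDeriv δ s u x := fun x => by
    rw [hwu, dirDeriv_add β hδ hs0, dirDeriv_smul_self, add_zero]
  have hq : ∀ x, dirDeriv δ s (Complex.I • w) x = dirDeriv δ s (Complex.I • u) x := fun x => by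
    rw [hIw, dirDeriv_add β hδ hs0, dirDeriv_smul_self, add_zero]
  -- Subtracting the value at `x₀` turns the oscillation bound into a bound on the absolute value.
  -- The subtracted constants, times `i s`, go into `a` and `a'`.
  refine fubiniStudy_pos h hS hU hus (P := fun x => dirDeriv δ s u x - dirDeriv δ s u x₀)
    (Q := fun x => dirDeriv δ s (Complex.I • u) x - dirDeriv δ s (Complex.I • u) x₀)
    ((measurable_dirDeriv β hδ hs0 u).sub_const _)
    ((measurable_dirDeriv β hδ hs0 (Complex.I • u)).sub_const _)
    (fun x => abs_sub_le_iff.2 ⟨hsmall.dirDeriv_sub_le hS hU hsu x x₀,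
      hsmall.dirDeriv_sub_le hS hU hsu x₀ x⟩) (fun x => ?_)
    (a := z + Complex.I * dirDeriv δ s u x₀)
    (a' := Complex.I * z + Complex.I * dirDeriv δ s (Complex.I • u) x₀)
    (fun x => norm_exp_I_mul (onSections δ s x)) (deformedSection_apply s) (fun x => ?_)
    (fun x => ?_)
  -- Multiplication by `I` preserves both the norm of `u` and its orthogonality to `s`, so the same
  -- bound holds along `I u`.
  · rw [← hIU] at hU ⊢
    exact abs_sub_le_iff.2 ⟨hsmall.dirDeriv_sub_le hS hU hsIu x x₀,
      hsmall.dirDeriv_sub_le hS hU hsIu x₀ x⟩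
  · rw [famDeriv_deformedSection β hδ A hb, ← hs, ← hw, hp]
    congr 1
    have h1 : w.1.1 x = u.1.1 x + z • s.1.1 x := congrArg (fun t : H0 n L => t.1.1 x) hwu
    rw [h1]
    push_cast
    module
  · rw [famDeriv_deformedSection β hδ A hb, ← hs, hη, map_smul, ← hw, hq]
    congr 1
    have h1 : (Complex.I • w).1.1 x = Complex.I • u.1.1 x + (Complex.I * z) • s.1.1 x :=
      congrArg (fun t : H0 n L => t.1.1 x) hIw
    rw [h1]
    push_cast
    module

end Symplectic

end DeformedSystem

open DeformedSystem in
theorem proposition7 {n : ℕ} {X : Type*} [TopologicalSpace X] [T2Space X] [CompactSpace X]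
    [SimplyConnectedSpace X] [ChartedSpace (Model n) X] [IsManifold 𝓘(ℂ, Model n) ω X]
    [MeasurableSpace X] [BorelSpace X]
    (L : X → Type*) [∀ x, AddCommGroup (L x)] [∀ x, Module ℂ (L x)]
    [TopologicalSpace (Bundle.TotalSpace ℂ L)] [∀ x, TopologicalSpace (L x)] [FiberBundle ℂ L]
    [VectorBundle ℂ ℂ L] [ContMDiffVectorBundle ω ℂ L 𝓘(ℂ, Model n)]
    (hL : IsVeryAmple n L) (h : HermitianMetric n L) (hh : IsKahler h) :
    FiniteDimensional ℂ (H0 n L) ∧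
    (∀ δ : ℙ ℂ (H0 n L) → SmoothFun n X, IsSmoothDeformation δ →
      IsSubmanifold (2 * (Module.finrank ℂ (H0 n L) - 1)) (deformedSystem δ)) ∧
    ∃ ε : ℝ, 0 < ε ∧ ∀ δ : ℙ ℂ (H0 n L) → SmoothFun n X, IsSmoothDeformation δ → IsSmall h ε δ →
      IsSymplecticSubmanifold (2 * (Module.finrank ℂ (H0 n L) - 1)) h (deformedSystem δ) := by
  have hfin : FiniteDimensional ℂ (H0 n L) := finiteDimensional_H0 h
  have : Module.Free ℂ (H0 n L) := Module.Free.of_divisionRing ℂ (H0 n L)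
  set β := Module.finBasis ℂ (H0 n L)
  -- The affine chart is centred at the given section, which is its point with parameter zero.
  have hmem : ∀ (δ : ℙ ℂ (H0 n L) → SmoothFun n X) {s : H0 n L} (hs : s ≠ 0) {k : ℕ}
      (A : EuclideanSpace ℝ (Fin k) →L[ℝ] (Fin (Module.finrank ℂ (H0 n L)) → ℂ)),
      Projectivization.mk ℂ (deformedSection δ s) (deformedSection_ne_zero hs) ∈
        projImage (fun b => deformedSection δ (β.equivFun.symm (β.equivFun s + A b))) univ := by
    intro δ s hs k A
    have h1 : β.equivFun.symm (β.equivFun s + A 0) = s := by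
      rw [map_zero, add_zero, LinearEquiv.symm_apply_apply]
    refine ⟨0, mem_univ _, ?_, ?_⟩
    · simp only [h1]
      exact deformedSection_ne_zero hs
    · simp only [h1]
  refine ⟨hfin, fun δ hδ p hp => ?_, 1 / 4, by norm_num, fun δ hδ hsmall p hp => ?_⟩
  · obtain ⟨s, hs, rfl⟩ := mem_deformedSystem.1 hp
    obtain ⟨l, A, A', hlc, hlA, hA', hAA'⟩ :=
      exists_affine_chart ((LinearEquiv.map_ne_zero_iff β.equivFun).2 hs)
    exact ⟨univ, _, isLocalParam_deformedSystem β hδ hlc hlA hA' hAA', hmem δ hs A⟩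
  · obtain ⟨s, hs, rfl⟩ := mem_deformedSystem.1 hp
    obtain ⟨l, A, A', hlc, hlA, hA', hAA'⟩ :=
      exists_affine_chart ((LinearEquiv.map_ne_zero_iff β.equivFun).2 hs)
    refine ⟨univ, _, isLocalParam_deformedSystem β hδ hlc hlA hA' hAA', hmem δ hs A, ?_⟩
    intro b _ ξ h0
    by_contra hξ
    have hlb : l (β.equivFun s + A b) = 1 := by rw [map_add, hlA, hlc, add_zero]
    have hAξ : A ξ ≠ 0 := fun h1 => hξ (by rw [← hA' ξ, h1, map_zero])
    -- The test vector is the tangent vector multiplied by `I` in the affine chart. This is possible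
    -- because the kernel of `l` is a complex subspace.
    refine (fubiniStudy_famDeriv_pos hh hδ hsmall β (b := b) (ξ := ξ)
      (η := A' (Complex.I • A ξ)) (c₀ := β.equivFun s) (fun h1 => ?_) (hAA' _ ?_)
      fun z hz => ?_).ne' (h0 _)
    · rw [h1, map_zero] at hlb
      exact zero_ne_one hlb
    · rw [map_smul, hlA, smul_zero]
    · have h1 := congrArg l hz
      rw [hlA, map_smul, hlb, smul_eq_mul, mul_one] at h1
      rw [← h1, zero_smul] at hz
      exact hAξ hz
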